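/- Let $G=(V,E)$ be a finite polytree, i.e. a directed acyclic graph whose underlying undirected graph is a tree. Let $\mathcal M^{\le 3}(G)$ be the set of pairs $(S,T)$ with $$S=(I-\Lambda)^{-T}\,\Omega^{(2)}\,(I-\Lambda)^{-1},\qquad T=\Omega^{(3)}\bullet(I-\Lambda)^{-1}\bullet(I-\Lambda)^{-1}\bullet(I-\Lambda)^{-1},$$ where $\Lambda\in\mathbb R^{V\times V}$ satisfies $\Lambda_{ij}=0$ whenever $i\to j\notin E$, $\Omega^{(2)}$ is a real diagonal matrix with positive diagonal, $\Omega^{(3)}$ is a real diagonal $V\times V\times V$ tensor, and $\bullet$ is the Tucker product, that is, $(\Omega\bullet B\bullet B\bullet B)_{ijk}=\sum_{a,b,c}\Omega_{abc}B_{ai}B_{bj}B_{ck}$. Let $\mathcal I^{\le 3}(G)\subseteq\mathbb C[s_{ij},t_{ijk}: i,j,k\in V]$ be the ideal of polynomials vanishing on $\mathcal M^{\le 3}(G)$, where the variables $s_{ij}$ and $t_{ijk}$ are symmetric in their indices. A $k$-trek between vertices $i_1,\dots,i_k$ is a collection of (possibly empty) directed paths with sinks $i_1,\dots,i_k$ and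 a common source, its top; it is simple if the top is the only vertex lying on all $k$ paths. In a polytree there is at most one simple $k$-trek between given vertices, and $\operatorname{top}(i_1,\dots,i_k)$ denotes its top if it exists. For $i,j\in V$ between which there is a $2$-trek, the trek-matrix $A_{i,j}$ is the matrix with two rows, indexed by $i$ and $j$, whose columns are $\binom{s_{ik}}{s_{jk}}$ for all $k\in V$ such that $\operatorname{top}(i,k)$ and $\operatorname{top}(j,k)$ exist and are equal, and $\binom{t_{i\ell m}}{t_{j\ell m}}$ for all pairs $(\ell,m)$ of vertices such that $\operatorname{top}(i,\ell,m)$ and $\operatorname{top}(j,\ell,m)$ exist and are equal. Let $V=H\cup O$ be an upstream partition, i.e. $H\cap O=\emptyset$ and there is no edge $o\to h$ with $o\in O$ and $h\in H$. Then the observed variable ideal $$\mathcal I^{\le 3}_O(G)=\mathcal I^{\le 3}(G)\cap\mathbb C[s_{ij},t_{ijk}: i,j,k\in O]$$ is generated, as an ideal of $\mathbb C[s_{ij},t_{ijk}: i,j,k\in O]$, by * the $2$-minors of the submatrices of the trek-matrices $A_{i,j}$ with $i,j\in O$ (such that there is a $2$-trek between $i$ and $j$) formed by the columns indexed by vertices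 $k\in O$ and by pairs $(\ell,m)$ with $\ell,m\in O$, together with * the variables $s_{ij}$ with $i,j\in O$ such that there is no $2$-trek between $i$ and $j$ in $G$, and the variables $t_{ijk}$ with $i,j,k\in O$ such that there is no $3$-trek between $i,j,k$ in $G$. -/

import Mathlib

open MvPolynomial

noncomputable section

namespace ThirdMoment

variable {V : Type*}

/-- A polytree: a directed graph without directed cycles whose underlying undirected graph is a
tree. -/
def IsPolytree (G : Digraph V) : Prop :=
  (∀ v, ¬ Relation.TransGen G.Adj v v) ∧ G.toSimpleGraphInclusive.IsTree

/-- `H ∪ O` is a partition of the vertices, and no edge goes from `O` to `H`. -/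
structure IsUpstreamPartition (G : Digraph V) (H O : Set V) : Prop where
  disjoint : Disjoint H O
  union : H ∪ O = Set.univ
  upstream : ∀ o ∈ O, ∀ h ∈ H, ¬ G.Adj o h

/-! ### Treks -/

/-- A directed path with source `v` and sink `w`, given by its list of vertices; the path with the
single vertex `v = w` (the empty path) is allowed. In an acyclic graph the vertices of such a
list are automatically distinct. -/
structure DiPath (G : Digraph V) (v w : V) where
  verts : List V
  isChain : verts.IsChain G.Adj
  head : verts.head? = some v
  last : verts.getLast? = some w

/-- A `k`-trek between `i 0, …, i (k-1)`: directed paths from a common source (the top) to the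
`i r`. -/
structure Trek (G : Digraph V) {k : ℕ} (i : Fin k → V) where
  top : V
  path : (r : Fin k) → DiPath G top (i r)

/-- A trek is simple if its top is the only vertex lying on all of its paths. -/
def Trek.IsSimple {G : Digraph V} {k : ℕ} {i : Fin k → V} (τ : Trek G i) : Prop :=
  ∀ v, (∀ r, v ∈ (τ.path r).verts) → v = τ.top

/-- `v` is the top of a simple trek between the vertices `i`. In a polytree there is at most one
simple trek between given vertices, so that this says `v = top(i 0, …, i (k-1))`. -/
def IsTop (G : Digraph V) {k : ℕ} (i : Fin k → V) (v : V) : Prop :=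
  ∃ τ : Trek G i, τ.IsSimple ∧ τ.top = v

/-- `top(i) = top(j)`: both tops exist and they coincide. -/
def SameTop (G : Digraph V) {k : ℕ} (i j : Fin k → V) : Prop :=
  ∃ v, IsTop G i v ∧ IsTop G j v

/-! ### The third-order moment model and its ideal -/

/-- The Tucker product `Ω • B • B • B`. -/
def tucker [Fintype V] (Ω : V → V → V → ℝ) (B : Matrix V V ℝ) : V → V → V → ℝ :=
  fun i j k => ∑ a, ∑ b, ∑ c, Ω a b c * B a i * B b j * B c k

/-- The diagonal order three tensor with diagonal `ω`. -/
def diagTensor [DecidableEq V] (ω : V → ℝ) : V → V → V → ℝ :=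
  fun a b c => if a = b ∧ b = c then ω a else 0

/-- The third-order moment model: the pairs of a covariance matrix and a third moment tensor
realizable under the linear structural equation model of `G`. -/
def momentModel [Fintype V] [DecidableEq V] (G : Digraph V) :
    Set (Matrix V V ℝ × (V → V → V → ℝ)) :=
  {p | ∃ (Λ : Matrix V V ℝ) (ω₂ ω₃ : V → ℝ),
    (∀ i j, ¬ G.Adj i j → Λ i j = 0) ∧ (∀ i, 0 < ω₂ i) ∧
    p.1 = ((1 - Λ)⁻¹).transpose * Matrix.diagonal ω₂ * (1 - Λ)⁻¹ ∧
    p.2 = tucker (diagTensor ω₃) (1 - Λ)⁻¹}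

/-- The indices of the variables `s_{ij}` and `t_{ijk}`, which are symmetric in `i, j` and in
`i, j, k`. -/
abbrev MomentVar (V : Type*) := Sym2 V ⊕ Sym V 3

/-- The index of `s_{ij}`. -/
def sIdx (i j : V) : MomentVar V := Sum.inl s(i, j)

/-- The index of `t_{ijk}`. -/
def tIdx (i j k : V) : MomentVar V := Sum.inr (i ::ₛ j ::ₛ k ::ₛ Sym.nil)

/-- The ring `ℂ[s_{ij}, t_{ijk}]`. -/
abbrev MomentRing (V : Type*) := MvPolynomial (MomentVar V) ℂ

/-- The variable `s_{ij}`. -/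
def sVar (i j : V) : MomentRing V := X (sIdx i j)

/-- The variable `t_{ijk}`. -/
def tVar (i j k : V) : MomentRing V := X (tIdx i j k)

/-- The points of the model, in the coordinates `s_{ij}`, `t_{ijk}`. -/
def modelPoints [Fintype V] [DecidableEq V] (G : Digraph V) : Set (MomentVar V → ℂ) :=
  {x | ∃ p ∈ momentModel G, (∀ i j, x (sIdx i j) = (p.1 i j : ℂ)) ∧
    ∀ i j k, x (tIdx i j k) = (p.2 i j k : ℂ)}

/-- Every element of the model has coordinates `s_{ij}`, `t_{ijk}`: the covariance matrices and the
third moment tensors in the model are symmetric. -/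
theorem exists_modelPoint [Fintype V] [DecidableEq V] (G : Digraph V)
    {p : Matrix V V ℝ × (V → V → V → ℝ)} (hp : p ∈ momentModel G) :
    ∃ x ∈ modelPoints G, (∀ i j, x (sIdx i j) = (p.1 i j : ℂ)) ∧
      ∀ i j k, x (tIdx i j k) = (p.2 i j k : ℂ) := by
  obtain ⟨Λ, ω₂, ω₃, -, -, h₁, h₂⟩ := id hp
  have hS : ∀ i j, p.1 i j = p.1 j i := fun i j => by
    rw [h₁, Matrix.mul_apply, Matrix.mul_apply]
    simp only [Matrix.mul_diagonal, Matrix.transpose_apply]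
    exact Finset.sum_congr rfl fun a _ => by ring
  have hT : ∀ i j k, p.2 i j k =
      ∑ a, ω₃ a * ((i ::ₘ j ::ₘ k ::ₘ 0).map fun b => (1 - Λ)⁻¹ a b).prod := fun i j k => by
    rw [h₂]
    simp [tucker, diagTensor, ite_and, Finset.sum_ite_eq, ite_mul, mul_assoc]
  let x : MomentVar V → ℂ := Sum.elim
    (Sym2.lift ⟨fun i j => (p.1 i j : ℂ), fun i j => congrArg _ (hS i j)⟩)
    fun q => ((∑ a, ω₃ a * ((q : Multiset V).map fun b => (1 - Λ)⁻¹ a b).prod : ℝ) : ℂ)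
  have hx : (∀ i j, x (sIdx i j) = (p.1 i j : ℂ)) ∧
      ∀ i j k, x (tIdx i j k) = (p.2 i j k : ℂ) := by
    refine ⟨fun i j => rfl, fun i j k => ?_⟩
    rw [hT]
    rfl
  exact ⟨x, ⟨p, hp, hx⟩, hx⟩

/-- The third-order moment ideal: the polynomials that vanish on the model. -/
def momentIdeal [Fintype V] [DecidableEq V] (G : Digraph V) : Ideal (MomentRing V) :=
  vanishingIdeal ℂ (modelPoints G)

/-! ### Trek-matrices -/

/-- The columns of the trek-matrix `A_{i,j}`: the vertices `k` with `top(i,k) = top(j,k)` and the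
pairs `(l,m)` with `top(i,l,m) = top(j,l,m)`. (Both `(l,m)` and `(m,l)` occur; this repeats a
column and does not change the ideal of the minors.) -/
abbrev TrekCol (G : Digraph V) (i j : V) :=
  {k : V // SameTop G ![i, k] ![j, k]} ⊕ {q : V × V // SameTop G ![i, q.1, q.2] ![j, q.1, q.2]}

/-- The trek-matrix `A_{i,j}`; its rows belong to `i` and `j`. -/
def trekMatrix (G : Digraph V) (i j : V) : Matrix (Fin 2) (TrekCol G i j) (MomentRing V) :=
  Matrix.of fun r c => match c with
    | Sum.inl k => sVar (![i, j] r) k.1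
    | Sum.inr q => tVar (![i, j] r) q.1.1 q.1.2

/-- The column is indexed by a vertex in `O` or by a pair of vertices in `O`. -/
def IsObservedCol {G : Digraph V} (O : Set V) {i j : V} : TrekCol G i j → Prop
  | Sum.inl k => k.1 ∈ O
  | Sum.inr q => q.1.1 ∈ O ∧ q.1.2 ∈ O

/-- The submatrix of `A_{i,j}` formed by the observed columns. -/
def observedTrekMatrix (G : Digraph V) (O : Set V) (i j : V) :
    Matrix (Fin 2) {c : TrekCol G i j // IsObservedCol O c} (MomentRing V) :=
  (trekMatrix G i j).submatrix id Subtype.val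

/-- The `2`-minors of the observed submatrices of the trek-matrices `A_{i,j}`, where `i, j ∈ O` and
there is a `2`-trek between `i` and `j`. -/
def observedMinors (G : Digraph V) (O : Set V) : Set (MomentRing V) :=
  {f | ∃ i ∈ O, ∃ j ∈ O, Nonempty (Trek G ![i, j]) ∧
    ∃ c d, f = ((observedTrekMatrix G O i j).submatrix id ![c, d]).det}

/-- The variables `s_{ij}` and `t_{ijk}` with observed indices between which there is no trek. -/
def observedLinear (G : Digraph V) (O : Set V) : Set (MomentRing V) :=
  {f | (∃ i ∈ O, ∃ j ∈ O, IsEmpty (Trek G ![i, j]) ∧ f = sVar i j) ∨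
    ∃ i ∈ O, ∃ j ∈ O, ∃ k ∈ O, IsEmpty (Trek G ![i, j, k]) ∧ f = tVar i j k}

/-! ### The observed variables -/

/-- The indices of the `s_{ij}` and `t_{ijk}` with `i, j, k ∈ O`. -/
def observedVars (O : Set V) : Set (MomentVar V) :=
  {x | (∃ i ∈ O, ∃ j ∈ O, x = sIdx i j) ∨ ∃ i ∈ O, ∃ j ∈ O, ∃ k ∈ O, x = tIdx i j k}

/-- The subring `ℂ[s_{ij}, t_{ijk} : i, j, k ∈ O]`. -/
abbrev observedRing (O : Set V) : Subalgebra ℂ (MomentRing V) := supported ℂ (observedVars O)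

/-- The observed variable ideal `I^{≤3}(G) ∩ ℂ[s_{ij}, t_{ijk} : i, j, k ∈ O]`, as an ideal of
the subring. -/
def observedIdeal [Fintype V] [DecidableEq V] (G : Digraph V) (O : Set V) :
    Ideal (observedRing O) :=
  (momentIdeal G).comap (observedRing O).val

theorem sVar_mem {O : Set V} {i j : V} (hi : i ∈ O) (hj : j ∈ O) : sVar i j ∈ observedRing O :=
  X_mem_supported.2 (Or.inl ⟨i, hi, j, hj, rfl⟩)

theorem tVar_mem {O : Set V} {i j k : V} (hi : i ∈ O) (hj : j ∈ O) (hk : k ∈ O) :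
    tVar i j k ∈ observedRing O :=
  X_mem_supported.2 (Or.inr ⟨i, hi, j, hj, k, hk, rfl⟩)

theorem observedTrekMatrix_mem {G : Digraph V} {O : Set V} {i j : V} (hi : i ∈ O) (hj : j ∈ O)
    (r : Fin 2) (c) : observedTrekMatrix G O i j r c ∈ observedRing O := by
  have h : ![i, j] r ∈ O := by fin_cases r <;> assumption
  obtain ⟨k | q, hc⟩ := c
  · exact sVar_mem h hc
  · exact tVar_mem h hc.1 hc.2

/-- All of the proposed generators lie in the subring of the observed variables. -/
theorem generators_subset (G : Digraph V) (O : Set V) :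
    observedMinors G O ∪ observedLinear G O ⊆ (observedRing O : Set (MomentRing V)) := by
  rintro f (⟨i, hi, j, hj, -, c, d, rfl⟩ | ⟨i, hi, j, hj, -, rfl⟩ | ⟨i, hi, j, hj, k, hk, -, rfl⟩)
  · rw [Matrix.det_fin_two]
    exact sub_mem
      (mul_mem (observedTrekMatrix_mem hi hj _ _) (observedTrekMatrix_mem hi hj _ _))
      (mul_mem (observedTrekMatrix_mem hi hj _ _) (observedTrekMatrix_mem hi hj _ _))
  · exact sVar_mem hi hj
  · exact tVar_mem hi hj hk

end ThirdMoment

end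

/-! Directed paths in a polytree are unique, so the entry of (I - Λ)⁻¹ at (a, i) is the product of
the edge weights along the path from a to i. If v is the greatest common ancestor of the indices of
a moment, then every path from a common ancestor to an index runs through v. The moment is therefore
the moment (v, v) or (v, v, v) times the path products from v to the indices. The moments (v, v) and
(v, v, v) depend on the error moments by an invertible triangular system, and the real parameters
with positive variances are Zariski dense. Hence a polynomial vanishing on the model lies in the
kernel of a monomial map (`IsPolytree.aeval_trekParam_eq_zero`), and observed polynomials lie in the
kernel of its restriction to the observed variables.

Such a kernel is governed by binomials (`aeval_eq_zero_of_monomial`), so it suffices to compare two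
collections of observed simple treks with equal exponents. The exponent records how many treks there
are of each size and top, and how many paths go from w to each child or end at w
(`IsPolytree.sameSteps_of_exponents`). A minor of A_{i,j} exchanges the sinks i and j between two
treks while keeping both tops and simplicity.

The core is `prod_eq_of_sameSteps`: such exchanges connect any two collections with the same steps.
Take one trek from each, of equal size and top. Where a path in the first leaves a path in the
second at w, by steps α ≠ β, one exchange in either collection makes them agree further. An exchange
with another trek is blocked only if that trek has top w, one path with step β and all others with
step α (or with α and β interchanged). If everything were blocked, the other treks would satisfy #β
≤ #α in the first collection and #α ≤ #β in the second. But equal totals force more β and fewer α in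
the first than in the second, a contradiction. Once the two treks coincide they are cancelled.

Conversely, the minors vanish on the model because the paths from two tops to i and j all pass the
least common descendant of the tops (`IsPolytree.pathProd_exchange`). -/

noncomputable section

namespace ThirdMoment

variable {V : Type*} {G : Digraph V}

/-! ### Reachability in a polytree -/

/-- There is a directed path from `v` to `w`. -/
def Reach (G : Digraph V) (v w : V) : Prop := Relation.ReflTransGen G.Adj v w

theorem Reach.refl (v : V) : Reach G v v := Relation.ReflTransGen.refl

theorem Reach.trans {u v w : V} (h₁ : Reach G u v) (h₂ : Reach G v w) : Reach G u w :=
  Relation.ReflTransGen.trans h₁ h₂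

theorem Reach.of_adj {u v : V} (h : G.Adj u v) : Reach G u v := Relation.ReflTransGen.single h

theorem Reach.eq_or_exists_adj {u v : V} (h : Reach G u v) :
    u = v ∨ ∃ y, G.Adj u y ∧ Reach G y v :=
  (Relation.ReflTransGen.cases_head h).imp_right fun ⟨y, h₁, h₂⟩ => ⟨y, h₁, h₂⟩

theorem IsPolytree.not_reach_of_adj (hG : IsPolytree G) {u v : V} (h : G.Adj u v) :
    ¬ Reach G v u := fun h' => hG.1 u (Relation.TransGen.head' h h')

theorem IsPolytree.ne_of_adj (hG : IsPolytree G) {u v : V} (h : G.Adj u v) : u ≠ v := by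
  rintro rfl
  exact hG.not_reach_of_adj h (Reach.refl u)

theorem IsPolytree.antisymm (hG : IsPolytree G) {u v : V} (h₁ : Reach G u v)
    (h₂ : Reach G v u) : u = v := by
  obtain h | ⟨y, hy, hyv⟩ := h₁.eq_or_exists_adj
  · exact h
  · exact absurd (hyv.trans h₂) (hG.not_reach_of_adj hy)

/-- The underlying graph without the edge `p → z`. -/
def cutGraph (G : Digraph V) (p z : V) : SimpleGraph V :=
  G.toSimpleGraphInclusive.deleteEdges {s(p, z)}

theorem IsPolytree.cutGraph_adj (hG : IsPolytree G) {p z x y : V} (hpz : G.Adj p z)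
    (h : G.Adj x y) (hne : ¬ (x = p ∧ y = z)) : (cutGraph G p z).Adj x y := by
  rw [cutGraph, SimpleGraph.deleteEdges_adj]
  refine ⟨⟨hG.ne_of_adj h, Or.inl h⟩, ?_⟩
  rw [Set.mem_singleton_iff, Sym2.eq_iff]
  rintro (h' | ⟨rfl, rfl⟩)
  · exact hne h'
  · exact hG.not_reach_of_adj h (Reach.of_adj hpz)

theorem IsPolytree.not_cutGraph_reachable (hG : IsPolytree G) {p z : V} (hpz : G.Adj p z) :
    ¬ (cutGraph G p z).Reachable p z :=
  SimpleGraph.isBridge_iff.1 (SimpleGraph.isAcyclic_iff_forall_isBridge.1 hG.2.isAcyclic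
    ((SimpleGraph.mem_edgeSet _).2
      (show G.toSimpleGraphInclusive.Adj p z from ⟨hG.ne_of_adj hpz, Or.inl hpz⟩)))

/-- A directed path either uses the edge `p → z` or survives its removal. -/
theorem IsPolytree.reach_cases (hG : IsPolytree G) {p z x y : V} (hpz : G.Adj p z)
    (h : Reach G x y) : (Reach G x p ∧ Reach G z y) ∨ (cutGraph G p z).Reachable x y := by
  induction h using Relation.ReflTransGen.head_induction_on with
  | refl => exact Or.inr (SimpleGraph.Reachable.refl _)
  | head h' hr ih =>
    rename_i a c
    obtain ⟨h₁, h₂⟩ | h₁ := ih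
    · exact Or.inl ⟨(Reach.of_adj h').trans h₁, h₂⟩
    · by_cases he : a = p ∧ c = z
      · obtain ⟨rfl, rfl⟩ := he
        exact Or.inl ⟨Reach.refl _, hr⟩
      · exact Or.inr ((hG.cutGraph_adj hpz h' he).reachable.trans h₁)

/-- Otherwise the edge `w → y'` and the paths to `j` would join `w` to `y` without the bridge `w →
y`. -/
theorem IsPolytree.child_unique (hG : IsPolytree G) {w y y' j : V} (h : G.Adj w y)
    (h' : G.Adj w y') (hj : Reach G y j) (hj' : Reach G y' j) : y = y' := by
  by_contra hne
  obtain ⟨h₁, -⟩ | h₁ := hG.reach_cases h hj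
  · exact hG.not_reach_of_adj h h₁
  obtain ⟨h₂, -⟩ | h₂ := hG.reach_cases h hj'
  · exact hG.not_reach_of_adj h' h₂
  have h₃ := (hG.cutGraph_adj h h' fun h => hne h.2.symm).reachable
  exact hG.not_cutGraph_reachable h ((h₃.trans h₂).trans h₁.symm)

/-- The vertices on the directed path between two given vertices form a chain. -/
theorem IsPolytree.total_of_reach (hG : IsPolytree G) {v u w a : V} (hvu : Reach G v u)
    (hvw : Reach G v w) (hua : Reach G u a) (hwa : Reach G w a) : Reach G u w ∨ Reach G w u := by
  induction hvu using Relation.ReflTransGen.head_induction_on with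
  | refl => exact Or.inl hvw
  | head h hr ih =>
    rename_i x y
    obtain rfl | ⟨y', hy', hyw⟩ := hvw.eq_or_exists_adj
    · exact Or.inr ((Reach.of_adj h).trans hr)
    · obtain rfl := hG.child_unique h hy' (Reach.trans hr hua) (hyw.trans hwa)
      exact ih hyw

/-- If `a` and `b` have a common descendant, then they have a least one. -/
theorem IsPolytree.exists_sup (hG : IsPolytree G) {a b i : V} (ha : Reach G a i)
    (hb : Reach G b i) : ∃ z, Reach G a z ∧ Reach G b z ∧
      ∀ j, Reach G a j → Reach G b j → Reach G z j := by
  induction ha with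
  | refl => exact ⟨a, Reach.refl _, hb, fun j h _ => h⟩
  | tail h hadj ih =>
    rename_i p z
    by_cases hbp : Reach G b p
    · exact ih hbp
    -- Here `z` is the first vertex on the path from `a` that `b` reaches. A common descendant `j`
    -- not behind `z` would connect `p` to `z` via `a`, `j` and `b` without the edge `p → z`.
    · refine ⟨z, Relation.ReflTransGen.tail h hadj, hb, fun j haj hbj => ?_⟩
      obtain ⟨-, h₁⟩ | h₁ := hG.reach_cases hadj haj
      · exact h₁
      obtain ⟨h₂, -⟩ | h₂ := hG.reach_cases hadj hbj
      · exact absurd h₂ hbp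
      obtain ⟨h₃, -⟩ | h₃ := hG.reach_cases hadj hb
      · exact absurd h₃ hbp
      obtain ⟨-, h₄⟩ | h₄ := hG.reach_cases hadj h
      · exact absurd h₄ (hG.not_reach_of_adj hadj)
      exact absurd (((h₄.symm.trans h₁).trans h₂.symm).trans h₃) (hG.not_cutGraph_reachable hadj)

/-! ### Steps of directed paths -/

/-- A directed path to `j` that passes `w` continues with the vertex `y`, or ends at `w = y`. -/
def Step (G : Digraph V) (w y j : V) : Prop := (y = w ∧ j = w) ∨ (G.Adj w y ∧ Reach G y j)

theorem Step.reach {w y j : V} (h : Step G w y j) : Reach G w j := by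
  obtain ⟨rfl, rfl⟩ | ⟨h₁, h₂⟩ := h
  · exact Reach.refl _
  · exact (Reach.of_adj h₁).trans h₂

theorem Reach.exists_step {w j : V} (h : Reach G w j) : ∃ y, Step G w y j := by
  obtain rfl | ⟨y, hy⟩ := h.eq_or_exists_adj
  · exact ⟨w, Or.inl ⟨rfl, rfl⟩⟩
  · exact ⟨y, Or.inr hy⟩

theorem IsPolytree.step_unique (hG : IsPolytree G) {w y y' j : V} (h : Step G w y j)
    (h' : Step G w y' j) : y = y' := by
  obtain ⟨rfl, rfl⟩ | ⟨h₁, h₂⟩ := h <;> obtain ⟨rfl, h₃⟩ | ⟨h₃, h₄⟩ := h'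
  · rfl
  · exact absurd h₄ (hG.not_reach_of_adj h₃)
  · exact absurd (h₃ ▸ h₂) (hG.not_reach_of_adj h₁)
  · exact hG.child_unique h₁ h₃ h₂ h₄

theorem Step.mono {u y w a : V} (h : Step G u y w) (hne : u ≠ w) (ha : Reach G w a) :
    Step G u y a := by
  obtain ⟨-, rfl⟩ | ⟨h₁, h₂⟩ := h
  · exact absurd rfl hne
  · exact Or.inr ⟨h₁, h₂.trans ha⟩

/-- Paths that pass `w` agree in their steps before `w`. -/
theorem IsPolytree.step_transfer (hG : IsPolytree G) {u y w a b : V} (hu : Reach G u w)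
    (hne : u ≠ w) (ha : Reach G w a) (hb : Reach G w b) (h : Step G u y a) :
    Step G u y b := by
  obtain ⟨y', hy'⟩ := hu.exists_step
  obtain rfl := hG.step_unique h (hy'.mono hne ha)
  exact hy'.mono hne hb

/-- Two different descendants of `v` branch at some descendant `w` of `v`. -/
theorem IsPolytree.exists_branch (hG : IsPolytree G) {v z i : V} (hz : Reach G v z)
    (hi : Reach G v i) (hne : z ≠ i) :
    ∃ w α β, Reach G v w ∧ Step G w α z ∧ Step G w β i ∧ α ≠ β := by
  induction hz using Relation.ReflTransGen.head_induction_on with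
  | refl =>
    obtain ⟨β, hβ⟩ := hi.exists_step
    refine ⟨z, z, β, Reach.refl _, Or.inl ⟨rfl, rfl⟩, hβ, ?_⟩
    rintro rfl
    obtain ⟨-, rfl⟩ | ⟨h, -⟩ := hβ
    · exact hne rfl
    · exact hG.ne_of_adj h rfl
  | head h hr ih =>
    rename_i x y
    obtain ⟨β, hβ⟩ := hi.exists_step
    by_cases hyβ : y = β
    · subst hyβ
      obtain ⟨rfl, -⟩ | ⟨-, h₂⟩ := hβ
      · exact absurd rfl (hG.ne_of_adj h)
      · obtain ⟨w, α, β, h₁, h₃⟩ := ih h₂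
        exact ⟨w, α, β, (Reach.of_adj h).trans h₁, h₃⟩
    · exact ⟨x, y, β, Reach.refl _, Or.inr ⟨h, hr⟩, hβ, hyβ⟩

/-! ### Tops of treks -/

theorem DiPath.reach {v w : V} (p : DiPath G v w) : Reach G v w := by
  obtain ⟨l, hc, hh, hl⟩ := p
  induction l generalizing v with
  | nil => simp at hh
  | cons a l ih =>
    obtain rfl : a = v := by simpa using hh
    cases l with
    | nil =>
      obtain rfl : a = w := by simpa using hl
      exact Reach.refl _
    | cons b l =>
      rw [List.isChain_cons_cons] at hc
      exact (Reach.of_adj hc.1).trans (ih hc.2 rfl (by simpa using hl))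

theorem DiPath.reach_of_mem {v w u : V} (p : DiPath G v w) (hu : u ∈ p.verts) :
    Reach G v u ∧ Reach G u w := by
  obtain ⟨l, hc, hh, hl⟩ := p
  change u ∈ l at hu
  induction l generalizing v with
  | nil => simp at hh
  | cons a l ih =>
    obtain rfl : a = v := by simpa using hh
    cases l with
    | nil =>
      obtain rfl : a = w := by simpa using hl
      obtain rfl : u = a := by simpa using hu
      exact ⟨Reach.refl _, Reach.refl _⟩
    | cons b l =>
      have hc' := List.isChain_cons_cons.1 hc
      have hl' : (b :: l).getLast? = some w := by simpa using hl
      obtain rfl | hu := List.mem_cons.1 hu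
      · exact ⟨Reach.refl _, DiPath.reach ⟨_, hc, hh, hl⟩⟩
      · obtain ⟨h₁, h₂⟩ := ih hc'.2 rfl hl' hu
        exact ⟨(Reach.of_adj hc'.1).trans h₁, h₂⟩

theorem DiPath.mem_verts (hG : IsPolytree G) {v w u : V} (p : DiPath G v w) (hvu : Reach G v u)
    (huw : Reach G u w) : u ∈ p.verts := by
  obtain ⟨l, hc, hh, hl⟩ := p
  change u ∈ l
  induction l generalizing v with
  | nil => simp at hh
  | cons a l ih =>
    obtain rfl : a = v := by simpa using hh
    cases l with
    | nil =>
      obtain rfl : a = w := by simpa using hl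
      simp [hG.antisymm huw hvu]
    | cons b l =>
      have hc' := List.isChain_cons_cons.1 hc
      have hl' : (b :: l).getLast? = some w := by simpa using hl
      obtain rfl | ⟨y, hy, hyu⟩ := hvu.eq_or_exists_adj
      · exact List.mem_cons_self
      · obtain rfl := hG.child_unique hy hc'.1 (hyu.trans huw)
          (DiPath.reach ⟨_, hc'.2, rfl, hl'⟩)
        exact List.mem_cons_of_mem _ (ih hyu hc'.2 rfl hl')

theorem Reach.nonempty_diPath {v w : V} (h : Reach G v w) : Nonempty (DiPath G v w) := by
  induction h using Relation.ReflTransGen.head_induction_on with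
  | refl => exact ⟨⟨[w], by simp, rfl, rfl⟩⟩
  | head h hr ih =>
    rename_i a c
    obtain ⟨⟨l, hc, hh, hl⟩⟩ := ih
    obtain ⟨l, rfl⟩ : ∃ l', l = c :: l' := by
      cases l with
      | nil => simp at hh
      | cons b l => exact ⟨l, by simpa using hh⟩
    exact ⟨⟨a :: c :: l, List.isChain_cons_cons.2 ⟨h, hc⟩, rfl, by simpa using hl⟩⟩

/-- `v` is the greatest common ancestor of the vertices in `Y`. -/
def IsMeet (G : Digraph V) (Y : Multiset V) (v : V) : Prop :=
  (∀ j ∈ Y, Reach G v j) ∧ ∀ u, (∀ j ∈ Y, Reach G u j) → Reach G u v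

/-- `v` is a common ancestor of the vertices in `Y`, and the paths to them do not all start with
the same edge. -/
def Branches (G : Digraph V) (Y : Multiset V) (v : V) : Prop :=
  (∀ j ∈ Y, Reach G v j) ∧ ∀ y, G.Adj v y → ¬ ∀ j ∈ Y, Reach G y j

theorem IsMeet.branches (hG : IsPolytree G) {Y : Multiset V} {v : V} (h : IsMeet G Y v) :
    Branches G Y v :=
  ⟨h.1, fun y hy hY => hG.not_reach_of_adj hy (h.2 y hY)⟩

theorem forall_mem_map_univ {k : ℕ} {i : Fin k → V} {P : V → Prop} :
    (∀ j ∈ Finset.univ.val.map i, P j) ↔ ∀ r, P (i r) := by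
  simp

theorem nonempty_trek_iff {k : ℕ} {i : Fin k → V} :
    Nonempty (Trek G i) ↔ ∃ v, ∀ j ∈ Finset.univ.val.map i, Reach G v j := by
  simp_rw [forall_mem_map_univ]
  constructor
  · rintro ⟨τ⟩
    exact ⟨τ.top, fun r => (τ.path r).reach⟩
  · rintro ⟨v, hv⟩
    exact ⟨⟨v, fun r => (hv r).nonempty_diPath.some⟩⟩

/-- Together with `IsMeet.branches` and `IsTop.isMeet` this makes three descriptions of a top
equivalent: the local one suits exchanges, the global one suits the trek rule. -/
theorem Branches.isTop {k : ℕ} [NeZero k] {i : Fin k → V} {v : V}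
    (h : Branches G (Finset.univ.val.map i) v) : IsTop G i v := by
  rw [Branches, forall_mem_map_univ] at h
  refine ⟨⟨v, fun r => (h.1 r).nonempty_diPath.some⟩, fun u hu => ?_, rfl⟩
  have hu' := fun r => DiPath.reach_of_mem _ (hu r)
  obtain h₁ | ⟨y, hy, hyu⟩ := (hu' 0).1.eq_or_exists_adj
  · exact h₁.symm
  · exact absurd (forall_mem_map_univ.2 fun r => hyu.trans (hu' r).2) (h.2 y hy)

/-- The least common descendant of the top and another common ancestor `u` lies on all paths of the
trek. By simplicity it is the top, so `u` reaches the top. -/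
theorem IsTop.isMeet (hG : IsPolytree G) {k : ℕ} [NeZero k] {i : Fin k → V} {v : V}
    (h : IsTop G i v) : IsMeet G (Finset.univ.val.map i) v := by
  obtain ⟨τ, hs, rfl⟩ := h
  have hτ := fun r => (τ.path r).reach
  refine ⟨forall_mem_map_univ.2 hτ, fun u hu => ?_⟩
  rw [forall_mem_map_univ] at hu
  obtain ⟨z, h₁, h₂, h₃⟩ := hG.exists_sup (hu 0) (hτ 0)
  rwa [← hs z fun r => DiPath.mem_verts hG _ h₂ (h₃ _ (hu r) (hτ r))]

theorem IsMeet.unique (hG : IsPolytree G) {Y : Multiset V} {v w : V} (hv : IsMeet G Y v)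
    (hw : IsMeet G Y w) : v = w :=
  hG.antisymm (hw.2 v hv.1) (hv.2 w hw.1)

/-- Vertices with a common ancestor have a greatest one. -/
theorem IsPolytree.exists_isMeet [Finite V] (hG : IsPolytree G) {Y : Multiset V} (hY : Y ≠ 0)
    {v : V} (hv : ∀ j ∈ Y, Reach G v j) : ∃ w, IsMeet G Y w := by
  classical
  let P : PartialOrder V :=
    { le := Reach G
      le_refl := Reach.refl
      le_trans := fun _ _ _ => Reach.trans
      le_antisymm := fun _ _ => hG.antisymm }
  obtain ⟨j₀, hj₀⟩ := Multiset.exists_mem_of_ne_zero hY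
  obtain ⟨w, hw⟩ := Set.Finite.exists_maximal (Set.toFinite {u | ∀ j ∈ Y, Reach G u j}) ⟨v, hv⟩
  refine ⟨w, hw.1, fun u hu => ?_⟩
  -- The least common descendant of `u` and `w` is again a common ancestor of `Y`, so maximality of
  -- `w` applies to it.
  obtain ⟨z, h₁, h₂, h₃⟩ := hG.exists_sup (hu j₀ hj₀) (hw.1 j₀ hj₀)
  exact h₁.trans (hw.2 (fun j hj => h₃ j (hu j hj) (hw.1 j hj)) h₂)

/-! ### Connecting collections of treks by exchanges

A trek is recorded as a pair of its top and the multiset of its sinks. -/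

open scoped Classical in
/-- The number of paths of the trek `t` that pass `w` and continue with `y`. -/
def stepCount (G : Digraph V) (w y : V) (t : V × Multiset V) : ℕ :=
  t.2.countP fun j => Reach G t.1 w ∧ Step G w y j

/-- `t` is a simple `2`- or `3`-trek with sinks in `O`. -/
structure IsObservedTrek (G : Digraph V) (O : Set V) (t : V × Multiset V) : Prop where
  card : t.2.card = 2 ∨ t.2.card = 3
  mem : ∀ j ∈ t.2, j ∈ O
  branches : Branches G t.2 t.1

/-- The collections `M` and `N` have the same numbers of treks of each size and top, and their
paths make the same steps. -/
structure SameSteps (G : Digraph V) (M N : Multiset (V × Multiset V)) : Prop where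
  type : M.map (fun t => (t.2.card, t.1)) = N.map fun t => (t.2.card, t.1)
  step : ∀ w y, (M.map (stepCount G w y)).sum = (N.map (stepCount G w y)).sum

namespace SameSteps

variable {M N K : Multiset (V × Multiset V)}

theorem symm (h : SameSteps G M N) : SameSteps G N M :=
  ⟨h.type.symm, fun w y => (h.step w y).symm⟩

theorem trans (h : SameSteps G M N) (h' : SameSteps G N K) : SameSteps G M K :=
  ⟨h.type.trans h'.type, fun w y => (h.step w y).trans (h'.step w y)⟩

theorem card_eq (h : SameSteps G M N) : M.card = N.card := by
  simpa using congrArg Multiset.card h.type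

theorem of_cons {t : V × Multiset V} (h : SameSteps G (t ::ₘ M) (t ::ₘ N)) :
    SameSteps G M N := by
  obtain ⟨h₁, h₂⟩ := h
  simp only [Multiset.map_cons, Multiset.sum_cons] at h₁ h₂
  exact ⟨(Multiset.cons_inj_right _).1 h₁, fun w y => Nat.add_left_cancel (h₂ w y)⟩

end SameSteps

/-- A vertex `u` on a path from `v` through `w` that `ρ` cannot reach lies strictly before `w`,
where the path does not yet depend on its sink. -/
theorem IsPolytree.step_iff_of_not_reach (hG : IsPolytree G) {v ρ w u y z j : V}
    (hv : Reach G v w) (hρ : Reach G ρ w) (hz : Reach G w z) (hj : Reach G w j)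
    (hvu : Reach G v u) (hρu : ¬ Reach G ρ u) : Step G u y z ↔ Step G u y j := by
  have key : ∀ {a b}, Reach G w a → Reach G w b → Step G u y a → Step G u y b := by
    intro a b ha hb h
    obtain h₁ | h₁ := hG.total_of_reach hvu hv h.reach ha
    · refine hG.step_transfer h₁ ?_ ha hb h
      rintro rfl
      exact hρu hρ
    · exact absurd (hρ.trans h₁) hρu
  exact ⟨key hz hj, key hj hz⟩

/-- Exchanging the sinks of two paths that pass the same vertex does not change the steps. -/
theorem IsPolytree.sameSteps_swap (hG : IsPolytree G) {v ρ w z j : V} (hv : Reach G v w)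
    (hρ : Reach G ρ w) (hz : Reach G w z) (hj : Reach G w j) (X Y : Multiset V)
    (M : Multiset (V × Multiset V)) :
    SameSteps G ((v, z ::ₘ X) ::ₘ (ρ, j ::ₘ Y) ::ₘ M) ((v, j ::ₘ X) ::ₘ (ρ, z ::ₘ Y) ::ₘ M) := by
  classical
  refine ⟨by simp, fun u y => ?_⟩
  simp only [Multiset.map_cons, Multiset.sum_cons, stepCount, Multiset.countP_cons]
  -- If both tops reach `u`, the two contributions trade places. If only one does, the step at `u`
  -- is the same for both sinks.
  by_cases h₁ : Reach G v u <;> by_cases h₂ : Reach G ρ u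
  · simp only [h₁, h₂, true_and]
    omega
  · simp only [h₁, h₂, true_and, false_and, hG.step_iff_of_not_reach hv hρ hz hj h₁ h₂]
  · simp only [h₁, h₂, true_and, false_and, hG.step_iff_of_not_reach hρ hv hz hj h₂ h₁]
  · simp only [h₁, h₂, false_and]

/-- Exchanging the sink of a path behind `w` keeps a trek simple, unless its top is `w` and the
new path starts with the same edge as all the other ones. -/
theorem IsPolytree.branches_exchange (hG : IsPolytree G) {ρ w z j : V} {Y : Multiset V}
    (h : Branches G (j ::ₘ Y) ρ) (hρ : Reach G ρ w) (hj : Reach G w j) (hz : Reach G w z)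
    (hw : ρ = w → ∀ y, G.Adj w y → Reach G y z → ¬ ∀ c ∈ Y, Reach G y c) :
    Branches G (z ::ₘ Y) ρ := by
  refine ⟨?_, fun y hy hY => ?_⟩
  · intro c hc
    obtain rfl | hc := Multiset.mem_cons.1 hc
    · exact hρ.trans hz
    · exact h.1 c (Multiset.mem_cons_of_mem hc)
  · have hyz := hY z (Multiset.mem_cons_self _ _)
    have hyY := fun c hc => hY c (Multiset.mem_cons_of_mem hc)
    by_cases hρw : ρ = w
    · subst hρw
      exact hw rfl y hy hyz hyY
    · refine h.2 y hy fun c hc => ?_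
      obtain rfl | hc := Multiset.mem_cons.1 hc
      · obtain ⟨rfl, -⟩ | ⟨-, h₂⟩ := hG.step_transfer hρ hρw hz hj (Or.inr ⟨hy, hyz⟩)
        · exact absurd rfl (hG.ne_of_adj hy)
        · exact h₂
      · exact hyY c hc

/-- If no sink of a path with step `β` at `w` can be exchanged for `z`, then there are at least
as many paths with step `α`. -/
theorem IsPolytree.stepCount_le (hG : IsPolytree G) {O : Set V} {t : V × Multiset V}
    (ht : IsObservedTrek G O t) {w z α β : V} (hz : Step G w α z) (hne : α ≠ β)
    (h : ∀ j ∈ t.2, ∀ Y, t.2 = j ::ₘ Y → Reach G t.1 w → Step G w β j →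
      ¬ Branches G (z ::ₘ Y) t.1) :
    stepCount G w β t ≤ stepCount G w α t := by
  classical
  by_cases h₀ : ∃ j ∈ t.2, Reach G t.1 w ∧ Step G w β j
  · obtain ⟨j, hj, hw, hβ⟩ := h₀
    obtain ⟨Y, hY⟩ := Multiset.exists_cons_of_mem hj
    have hblock := h j hj Y hY hw hβ
    have hbr := ht.branches
    rw [hY] at hbr
    -- The exchange can only be blocked because all remaining paths start at the top `w` with the
    -- edge towards `z`. Then one path has step `β`, and the others, at least one, have step `α`.
    have : t.1 = w ∧ ∃ y, G.Adj w y ∧ Reach G y z ∧ ∀ c ∈ Y, Reach G y c := by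
      by_contra hcon
      refine hblock (hG.branches_exchange hbr hw hβ.reach hz.reach ?_)
      intro h₁ y h₂ h₃ h₄
      exact hcon ⟨h₁, y, h₂, h₃, h₄⟩
    obtain ⟨htw, y, hy, hyz, hyY⟩ := this
    obtain rfl := hG.step_unique hz (Or.inr ⟨hy, hyz⟩)
    have hαY : ∀ c ∈ Y, Step G w α c := fun c hc => Or.inr ⟨hy, hyY c hc⟩
    have hcard : 1 ≤ Y.card := by
      have := ht.card
      rw [hY, Multiset.card_cons] at this
      omega
    have e₁ : stepCount G w β t = 1 := by
      rw [stepCount, hY, Multiset.countP_cons_of_pos _ ⟨hw, hβ⟩, Multiset.countP_eq_zero.2]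
      rintro c hc ⟨-, hc'⟩
      exact hne (hG.step_unique (hαY c hc) hc')
    have e₂ : Y.card ≤ stepCount G w α t := by
      rw [stepCount, hY]
      refine le_trans ?_ (Multiset.countP_le_of_le _ (Multiset.le_cons_self Y j))
      rw [Multiset.countP_eq_card.2 fun c hc => ⟨hw, hαY c hc⟩]
    omega
  · rw [stepCount, Multiset.countP_eq_zero.2]
    · exact Nat.zero_le _
    · exact fun j hj hcon => h₀ ⟨j, hj, hcon⟩

/-! ### Exchange relations connect collections of treks with the same steps -/

section Exchange

variable {Q : Type*} [CommMonoid Q] {O : Set V} {x : V × Multiset V → Q}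

/-- The quadratic exchange relations. -/
def ExchangeRelations (G : Digraph V) (O : Set V) (x : V × Multiset V → Q) : Prop :=
  ∀ τ ρ i j X Y, IsObservedTrek G O (τ, i ::ₘ X) → IsObservedTrek G O (τ, j ::ₘ X) →
    IsObservedTrek G O (ρ, j ::ₘ Y) → IsObservedTrek G O (ρ, i ::ₘ Y) →
    x (τ, i ::ₘ X) * x (ρ, j ::ₘ Y) = x (τ, j ::ₘ X) * x (ρ, i ::ₘ Y)

/-- Either the sink `z` of a path of the trek `(v, z ::ₘ X)` with step `α` at `w` can be exchanged
for the sink of some path with step `β`, or there are at least as many other paths with step `α` as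
there are with step `β`. -/
theorem exists_exchange_or_le (hG : IsPolytree G) (hx : ExchangeRelations G O x)
    {v w z α β : V} {X : Multiset V} {M : Multiset (V × Multiset V)}
    (hv : Reach G v w) (hz : Step G w α z) (hne : α ≠ β)
    (hT : IsObservedTrek G O (v, z ::ₘ X)) (hM : ∀ t ∈ M, IsObservedTrek G O t)
    (hβ : ∀ j, Step G w β j → Branches G (j ::ₘ X) v) :
    (∃ j M', Step G w β j ∧ IsObservedTrek G O (v, j ::ₘ X) ∧
      (∀ t ∈ M', IsObservedTrek G O t) ∧
      SameSteps G ((v, z ::ₘ X) ::ₘ M) ((v, j ::ₘ X) ::ₘ M') ∧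
      x (v, z ::ₘ X) * (M.map x).prod = x (v, j ::ₘ X) * (M'.map x).prod) ∨
    (M.map (stepCount G w β)).sum ≤ (M.map (stepCount G w α)).sum := by
  by_cases h₀ : ∃ t ∈ M, ∃ j ∈ t.2, ∃ Y, t.2 = j ::ₘ Y ∧ Reach G t.1 w ∧ Step G w β j ∧
      Branches G (z ::ₘ Y) t.1
  · left
    obtain ⟨⟨ρ, S⟩, ht, j, -, Y, hY, hρ, hj, hbr⟩ := h₀
    obtain rfl : S = j ::ₘ Y := hY
    obtain ⟨M₁, rfl⟩ := Multiset.exists_cons_of_mem ht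
    have hS := hM _ ht
    have hT' : IsObservedTrek G O (v, j ::ₘ X) := by
      refine ⟨by simpa using hT.card, ?_, hβ j hj⟩
      intro c hc
      obtain rfl | hc := Multiset.mem_cons.1 hc
      · exact hS.mem _ (Multiset.mem_cons_self _ _)
      · exact hT.mem c (Multiset.mem_cons_of_mem hc)
    have hS' : IsObservedTrek G O (ρ, z ::ₘ Y) := by
      refine ⟨by simpa using hS.card, ?_, hbr⟩
      intro c hc
      obtain rfl | hc := Multiset.mem_cons.1 hc
      · exact hT.mem _ (Multiset.mem_cons_self _ _)
      · exact hS.mem c (Multiset.mem_cons_of_mem hc)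
    refine ⟨j, (ρ, z ::ₘ Y) ::ₘ M₁, hj, hT', ?_,
      hG.sameSteps_swap hv hρ hz.reach hj.reach X Y M₁, ?_⟩
    · intro t ht
      obtain rfl | ht := Multiset.mem_cons.1 ht
      · exact hS'
      · exact hM t (Multiset.mem_cons_of_mem ht)
    · simp only [Multiset.map_cons, Multiset.prod_cons]
      rw [← mul_assoc, ← mul_assoc, hx _ _ _ _ _ _ hT hT' hS hS']
  · right
    refine Multiset.sum_map_le_sum_map _ _ fun t ht => ?_
    refine hG.stepCount_le (hM t ht) hz hne fun j hj Y hY h₁ h₂ h₃ => ?_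
    exact h₀ ⟨t, ht, j, hj, Y, hY, h₁, h₂, h₃⟩

/-- The common steps of the paths from `v` to `z` and from `v` to `i`. -/
def commonSteps (G : Digraph V) (v z i : V) : Set (V × V) :=
  {p | Reach G v p.1 ∧ Step G p.1 p.2 z ∧ Step G p.1 p.2 i}

theorem commonSteps_comm (v z i : V) : commonSteps G v z i = commonSteps G v i z := by
  ext p
  simp only [commonSteps, Set.mem_ofPred_eq]
  tauto

/-- All common steps of the paths to `z` and `i` occur before the branching vertex `w`, where the
path to `j` agrees with them. The step `(w, β)` is new. -/
theorem IsPolytree.commonSteps_ssubset (hG : IsPolytree G) {v w z j i α β : V}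
    (hv : Reach G v w) (hz : Step G w α z) (hi : Step G w β i) (hj : Step G w β j)
    (hne : α ≠ β) : commonSteps G v z i ⊂ commonSteps G v j i := by
  refine Set.ssubset_iff_exists.2 ⟨?_, (w, β), ⟨hv, hj, hi⟩, fun h => ?_⟩
  · rintro ⟨u, y⟩ ⟨h₁, h₂, h₃⟩
    refine ⟨h₁, ?_, h₃⟩
    dsimp only at h₁ h₂ h₃ ⊢
    have huw : u ≠ w := by
      rintro rfl
      exact hne ((hG.step_unique hz h₂).trans (hG.step_unique h₃ hi))
    obtain h₄ | h₄ := hG.total_of_reach h₁ hv h₂.reach hz.reach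
    · exact hG.step_transfer h₄ huw hz.reach hj.reach h₂
    · obtain ⟨y', hy'⟩ := h₄.exists_step
      have e₁ := hG.step_unique hz (hy'.mono huw.symm h₂.reach)
      have e₂ := hG.step_unique hi (hy'.mono huw.symm h₃.reach)
      exact absurd (e₁.trans e₂.symm) hne
  · exact hne (hG.step_unique hz h.2.1)

/-- A failure needs top `w` and all sinks in `C + Z` behind the edge to `β`. Then `Z`, hence also
`X`, is empty, and the trek with sinks `i ::ₘ C` would not branch either. -/
theorem IsPolytree.branches_of_step (hG : IsPolytree G) {v w z i j β : V}
    {C Z X : Multiset V} (hv : Reach G v w) (hz : Reach G w z) (hi : Step G w β i)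
    (hj : Step G w β j) (hZ : Branches G (z ::ₘ (C + Z)) v) (hX : Branches G (i ::ₘ (C + X)) v)
    (hcard : Z.card = X.card) (hβ : ∀ c ∈ Z, ¬ Step G w β c) :
    Branches G (j ::ₘ (C + Z)) v := by
  refine hG.branches_exchange hZ hv hz hj.reach ?_
  rintro rfl y hy hyj hY
  obtain rfl := hG.step_unique hj (Or.inr ⟨hy, hyj⟩)
  obtain rfl : Z = 0 := Multiset.eq_zero_of_forall_notMem fun c hc =>
    hβ c hc (Or.inr ⟨hy, hY c (Multiset.mem_add.2 (Or.inr hc))⟩)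
  obtain rfl : X = 0 := by simpa using hcard.symm
  refine hX.2 β hy fun c hc => ?_
  obtain rfl | hc := Multiset.mem_cons.1 hc
  · obtain ⟨rfl, -⟩ | ⟨-, h⟩ := hi
    · exact absurd rfl (hG.ne_of_adj hy)
    · exact h
  · exact hY c hc

/-- The totals agree and `C` contributes equally. The sink `i` adds a step `β` on one side, while
`z` and `Z` add none on the other. -/
theorem IsPolytree.sum_stepCount_lt {v w z i α β : V} (hG : IsPolytree G) {C Z X : Multiset V}
    {M N : Multiset (V × Multiset V)} (hv : Reach G v w) (hz : Step G w α z) (hi : Step G w β i)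
    (hne : α ≠ β) (hβ : ∀ c ∈ Z, ¬ Step G w β c)
    (h : SameSteps G ((v, z ::ₘ (C + Z)) ::ₘ M) ((v, i ::ₘ (C + X)) ::ₘ N)) :
    (N.map (stepCount G w β)).sum < (M.map (stepCount G w β)).sum := by
  classical
  have h₁ := h.step w β
  simp only [Multiset.map_cons, Multiset.sum_cons] at h₁
  have hzβ : ¬ Step G w β z := fun h => hne (hG.step_unique hz h)
  have e₁ : stepCount G w β (v, z ::ₘ (C + Z)) =
      C.countP fun j => Reach G v w ∧ Step G w β j := by
    rw [stepCount, Multiset.countP_cons_of_neg _ (fun h => hzβ h.2), Multiset.countP_add,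
      Multiset.countP_eq_zero.2 fun c hc h => hβ c hc h.2, add_zero]
  have e₂ : (C.countP fun j => Reach G v w ∧ Step G w β j) <
      stepCount G w β (v, i ::ₘ (C + X)) := by
    rw [stepCount, Multiset.countP_cons_of_pos _ ⟨hv, hi⟩, Multiset.countP_add, Nat.lt_succ_iff]
    convert Nat.le_add_right _ _
  omega

/-- The inductive step: if the claim holds for treks `(v, C + Z)` and `(v, C + X)` that differ in at
most `n` sinks, then it holds for treks that differ in at most `n + 1` sinks. -/
theorem prod_eq_of_commonSteps [Finite V] (hG : IsPolytree G) (hx : ExchangeRelations G O x)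
    {v : V} {n m : ℕ}
    (IH : ∀ C Z X : Multiset V, ∀ M N : Multiset (V × Multiset V), Z.card = n → X.card = n →
      M.card = m → IsObservedTrek G O (v, C + Z) → IsObservedTrek G O (v, C + X) →
      (∀ t ∈ M, IsObservedTrek G O t) → (∀ t ∈ N, IsObservedTrek G O t) →
      SameSteps G ((v, C + Z) ::ₘ M) ((v, C + X) ::ₘ N) →
      x (v, C + Z) * (M.map x).prod = x (v, C + X) * (N.map x).prod) (d : ℕ) :
    ∀ (C Z X : Multiset V) (z i : V) (M N : Multiset (V × Multiset V)), Z.card = n →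
      X.card = n → M.card = m → IsObservedTrek G O (v, z ::ₘ (C + Z)) →
      IsObservedTrek G O (v, i ::ₘ (C + X)) →
      (∀ t ∈ M, IsObservedTrek G O t) → (∀ t ∈ N, IsObservedTrek G O t) →
      SameSteps G ((v, z ::ₘ (C + Z)) ::ₘ M) ((v, i ::ₘ (C + X)) ::ₘ N) →
      Nat.card (V × V) ≤ d + (commonSteps G v z i).ncard →
      x (v, z ::ₘ (C + Z)) * (M.map x).prod = x (v, i ::ₘ (C + X)) * (N.map x).prod := by
  -- The number `d` bounds how many pairs are not yet common steps; each gain of a common step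
  -- lowers it.
  have hlt : ∀ {d z i j k}, Nat.card (V × V) ≤ d + (commonSteps G v z i).ncard →
      commonSteps G v z i ⊂ commonSteps G v j k →
      ∃ d' < d, Nat.card (V × V) ≤ d' + (commonSteps G v j k).ncard := by
    intro d z i j k h₁ h₂
    have h₃ := Set.ncard_lt_ncard h₂ (Set.toFinite _)
    have h₄ := Set.ncard_le_card (commonSteps G v j k)
    exact ⟨d - 1, by omega, by omega⟩
  induction d using Nat.strong_induction_on with
  | _ d ih =>
    intro C Z X z i M N hZc hXc hMc hZ hX hM hN hMN hd
    by_cases hzi : z = i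
    · subst hzi
      have := IH (z ::ₘ C) Z X M N hZc hXc hMc
      simp only [Multiset.cons_add] at this
      exact this hZ hX hM hN hMN
    obtain ⟨w, α, β, hv, hα, hβ, hne⟩ := hG.exists_branch
      (hZ.branches.1 z (Multiset.mem_cons_self _ _)) (hX.branches.1 i (Multiset.mem_cons_self _ _))
      hzi
    have hd₁ : ∀ j, Step G w β j →
        ∃ d' < d, Nat.card (V × V) ≤ d' + (commonSteps G v j i).ncard :=
      fun j hj => hlt hd (hG.commonSteps_ssubset hv hα hβ hj hne)
    have hd₂ : ∀ j, Step G w α j →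
        ∃ d' < d, Nat.card (V × V) ≤ d' + (commonSteps G v z j).ncard := by
      intro j hj
      rw [commonSteps_comm] at hd ⊢
      exact hlt hd (hG.commonSteps_ssubset hv hβ hα hj hne.symm)
    -- If another unmatched sink already takes the right step at `w`, it is matched instead, and the
    -- collections stay unchanged.
    by_cases hZβ : ∃ c ∈ Z, Step G w β c
    · obtain ⟨c, hc, hcβ⟩ := hZβ
      obtain ⟨Z, rfl⟩ := Multiset.exists_cons_of_mem hc
      have e : z ::ₘ (C + c ::ₘ Z) = c ::ₘ (C + z ::ₘ Z) := by
        simp only [Multiset.add_cons, Multiset.cons_swap z c]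
      rw [e] at hZ hMN ⊢
      obtain ⟨d', hd', hle⟩ := hd₁ c hcβ
      exact ih d' hd' C (z ::ₘ Z) X c i M N (by simpa using hZc) hXc hMc hZ hX hM hN hMN hle
    by_cases hXα : ∃ c ∈ X, Step G w α c
    · obtain ⟨c, hc, hcα⟩ := hXα
      obtain ⟨X, rfl⟩ := Multiset.exists_cons_of_mem hc
      have e : i ::ₘ (C + c ::ₘ X) = c ::ₘ (C + i ::ₘ X) := by
        simp only [Multiset.add_cons, Multiset.cons_swap i c]
      rw [e] at hX hMN ⊢
      obtain ⟨d', hd', hle⟩ := hd₂ c hcα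
      exact ih d' hd' C Z (i ::ₘ X) z c M N hZc (by simpa using hXc) hMc hZ hX hM hN hMN hle
    push Not at hZβ hXα
    obtain ⟨j, M', hj, hj', hM', hs, he⟩ | hle := exists_exchange_or_le hG hx hv hα hne hZ hM
      fun j hj => hG.branches_of_step hv hα.reach hβ hj hZ.branches hX.branches
        (hZc.trans hXc.symm) hZβ
    · rw [he]
      have hc := hs.card_eq
      simp only [Multiset.card_cons] at hc
      obtain ⟨d', hd', hle⟩ := hd₁ j hj
      exact ih d' hd' C Z X j i M' N hZc hXc (by omega) hj' hX hM' hN (hs.symm.trans hMN) hle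
    obtain ⟨j, N', hj, hj', hN', hs, he⟩ | hle' := exists_exchange_or_le hG hx hv hβ hne.symm hX hN
      fun j hj => hG.branches_of_step hv hβ.reach hα hj hX.branches hZ.branches
        (hXc.trans hZc.symm) hXα
    · rw [he]
      obtain ⟨d', hd', hle⟩ := hd₂ j hj
      exact ih d' hd' C Z X z j M N' hZc hXc hMc hZ hj' hM hN' (hMN.trans hs) hle
    -- No exchange is possible in either collection, and the four inequalities form a strict cycle:
    -- M_β ≤ M_α < N_α ≤ N_β < M_β.
    have h₁ := hG.sum_stepCount_lt hv hα hβ hne hZβ hMN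
    have h₂ := hG.sum_stepCount_lt hv hβ hα hne.symm hXα hMN.symm
    omega

/-- Collections of simple treks with the same steps have the same product in every commutative
monoid in which the exchange relations hold. -/
theorem prod_eq_of_sameSteps [Finite V] (hG : IsPolytree G) (hx : ExchangeRelations G O x)
    {M N : Multiset (V × Multiset V)} (hM : ∀ t ∈ M, IsObservedTrek G O t)
    (hN : ∀ t ∈ N, IsObservedTrek G O t) (h : SameSteps G M N) :
    (M.map x).prod = (N.map x).prod := by
  induction hm : M.card generalizing M N with
  | zero =>
    have hc := h.card_eq
    rw [hm] at hc
    rw [Multiset.card_eq_zero.1 hm, Multiset.card_eq_zero.1 hc.symm]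
  | succ m ihm =>
    obtain ⟨⟨v, S⟩, hS⟩ := Multiset.card_pos_iff_exists_mem.1 (show 0 < M.card by omega)
    obtain ⟨M, rfl⟩ := Multiset.exists_cons_of_mem hS
    have hmem : (S.card, v) ∈ N.map fun t => (t.2.card, t.1) := by
      rw [← h.type]
      simp
    obtain ⟨⟨v', S'⟩, hS', heq⟩ := Multiset.mem_map.1 hmem
    obtain ⟨hcard, rfl⟩ := Prod.mk.inj heq
    dsimp only at hcard h hS hM
    obtain ⟨N, rfl⟩ := Multiset.exists_cons_of_mem hS'
    simp only [Multiset.map_cons, Multiset.prod_cons]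
    -- The sinks in `C` are already matched and `n` counts the unmatched ones. For `n = 0` the two
    -- treks coincide and are cancelled, which leaves `m` treks.
    have key : ∀ n : ℕ, ∀ C Z X : Multiset V, ∀ M N : Multiset (V × Multiset V), Z.card = n →
        X.card = n → M.card = m → IsObservedTrek G O (v', C + Z) →
        IsObservedTrek G O (v', C + X) →
        (∀ t ∈ M, IsObservedTrek G O t) → (∀ t ∈ N, IsObservedTrek G O t) →
        SameSteps G ((v', C + Z) ::ₘ M) ((v', C + X) ::ₘ N) →
        x (v', C + Z) * (M.map x).prod = x (v', C + X) * (N.map x).prod := by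
      intro n
      induction n with
      | zero =>
        intro C Z X M N hZ hX hMc _ _ hM hN h
        obtain rfl := Multiset.card_eq_zero.1 hZ
        obtain rfl := Multiset.card_eq_zero.1 hX
        rw [ihm hM hN h.of_cons hMc]
      | succ n ihn =>
        intro C Z X M N hZc hXc hMc hZ hX hM hN h
        obtain ⟨z, Z, rfl, hZ'⟩ := Multiset.card_eq_succ_iff.1 hZc
        obtain ⟨i, X, rfl, hX'⟩ := Multiset.card_eq_succ_iff.1 hXc
        simp only [Multiset.add_cons] at hZ hX h ⊢
        exact prod_eq_of_commonSteps hG hx ihn _ C Z X z i M N hZ' hX' hMc hZ hX hM hN h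
          (Nat.le_add_right _ _)
    have := key S.card 0 S S' M N rfl hcard (by simpa using hm)
    simp only [zero_add] at this
    exact this (hM _ hS) (hN _ hS') (fun t ht => hM t (Multiset.mem_cons_of_mem ht))
      (fun t ht => hN t (Multiset.mem_cons_of_mem ht)) h

end Exchange

/-! ### Path products and the trek rule -/

section PathProd

variable [Fintype V] {R : Type*} [CommRing R]

open scoped Classical in
/-- The edges of the directed path from `u` to `i`. -/
def pathEdges (G : Digraph V) (u i : V) : Finset (V × V) :=
  Finset.univ.filter fun e => G.Adj e.1 e.2 ∧ Reach G u e.1 ∧ Reach G e.2 i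

theorem mem_pathEdges {u i : V} {e : V × V} :
    e ∈ pathEdges G u i ↔ G.Adj e.1 e.2 ∧ Reach G u e.1 ∧ Reach G e.2 i := by
  classical
  simp [pathEdges]

theorem IsPolytree.pathEdges_self (hG : IsPolytree G) (u : V) : pathEdges G u u = ∅ := by
  refine Finset.eq_empty_of_forall_notMem fun e he => ?_
  obtain ⟨h₁, h₂, h₃⟩ := mem_pathEdges.1 he
  exact hG.not_reach_of_adj h₁ (h₃.trans h₂)

theorem IsPolytree.notMem_pathEdges (hG : IsPolytree G) {u w : V} (h : G.Adj u w) (i : V) :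
    (u, w) ∉ pathEdges G w i := fun he => hG.not_reach_of_adj h (mem_pathEdges.1 he).2.1

theorem IsPolytree.pathEdges_of_adj [DecidableEq V] (hG : IsPolytree G) {u w i : V}
    (h : G.Adj u w) (hi : Reach G w i) :
    pathEdges G u i = insert (u, w) (pathEdges G w i) := by
  ext ⟨x, y⟩
  simp only [mem_pathEdges, Finset.mem_insert, Prod.mk.injEq]
  constructor
  · rintro ⟨h₁, h₂, h₃⟩
    obtain rfl | ⟨c, hc, hcx⟩ := h₂.eq_or_exists_adj
    · exact Or.inl ⟨rfl, hG.child_unique h₁ h h₃ hi⟩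
    · obtain rfl := hG.child_unique hc h ((hcx.trans (Reach.of_adj h₁)).trans h₃) hi
      exact Or.inr ⟨h₁, hcx, h₃⟩
  · rintro (⟨rfl, rfl⟩ | ⟨h₁, h₂, h₃⟩)
    · exact ⟨h, Reach.refl _, hi⟩
    · exact ⟨h₁, (Reach.of_adj h).trans h₂, h₃⟩

open scoped Classical in
/-- The product of the edge weights on the directed path from `u` to `i`. -/
def pathProd (G : Digraph V) (Λ : V × V → R) (u i : V) : R :=
  if Reach G u i then ∏ e ∈ pathEdges G u i, Λ e else 0

theorem pathProd_of_reach {u i : V} (h : Reach G u i) (Λ : V × V → R) :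
    pathProd G Λ u i = ∏ e ∈ pathEdges G u i, Λ e := if_pos h

theorem pathProd_of_not_reach {u i : V} (h : ¬ Reach G u i) (Λ : V × V → R) :
    pathProd G Λ u i = 0 := if_neg h

theorem IsPolytree.pathProd_self (hG : IsPolytree G) (Λ : V × V → R) (u : V) :
    pathProd G Λ u u = 1 := by
  rw [pathProd_of_reach (Reach.refl u), hG.pathEdges_self, Finset.prod_empty]

theorem IsPolytree.pathProd_of_adj (hG : IsPolytree G) (Λ : V × V → R) {u w i : V}
    (h : G.Adj u w) (hi : Reach G w i) :
    pathProd G Λ u i = Λ (u, w) * pathProd G Λ w i := by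
  classical
  rw [pathProd_of_reach ((Reach.of_adj h).trans hi), pathProd_of_reach hi,
    hG.pathEdges_of_adj h hi, Finset.prod_insert (hG.notMem_pathEdges h i)]

theorem IsPolytree.pathProd_mul (hG : IsPolytree G) (Λ : V × V → R) {u v i : V}
    (h : Reach G u v) (hi : Reach G v i) :
    pathProd G Λ u i = pathProd G Λ u v * pathProd G Λ v i := by
  induction h using Relation.ReflTransGen.head_induction_on with
  | refl => rw [hG.pathProd_self, one_mul]
  | head h hr ih =>
    rw [hG.pathProd_of_adj Λ h (Reach.trans hr hi), hG.pathProd_of_adj Λ h hr, ih, mul_assoc]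

/-- Weights off the edges are irrelevant, so they may be free parameters although the model requires
them to be zero. -/
theorem pathProd_congr {Λ Λ' : V × V → R} (h : ∀ u w, G.Adj u w → Λ (u, w) = Λ' (u, w)) :
    pathProd G Λ = pathProd G Λ' := by
  funext u i
  unfold pathProd
  split_ifs
  · exact Finset.prod_congr rfl fun e he => h e.1 e.2 (mem_pathEdges.1 he).1
  · rfl

theorem map_pathProd {S : Type*} [CommRing S] (φ : R →+* S) (Λ : V × V → R) (u i : V) :
    φ (pathProd G Λ u i) = pathProd G (φ ∘ Λ) u i := by
  unfold pathProd
  split_ifs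
  · rw [map_prod]
    rfl
  · exact map_zero φ

/-- This is (I - Λ)P = I for the matrix P of path products. At most one child of `u` leads to `i`,
so the sum has at most one nonzero term. -/
theorem IsPolytree.pathProd_rec [DecidableEq V] (hG : IsPolytree G) {Λ : V × V → R}
    (hΛ : ∀ u w, ¬ G.Adj u w → Λ (u, w) = 0) (u i : V) :
    pathProd G Λ u i = (if u = i then 1 else 0) + ∑ w, Λ (u, w) * pathProd G Λ w i := by
  by_cases h : Reach G u i
  · obtain rfl | ⟨w, hw, hi⟩ := h.eq_or_exists_adj
    · rw [if_pos rfl, hG.pathProd_self, Finset.sum_eq_zero, add_zero]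
      intro w _
      by_cases hw : G.Adj u w
      · rw [pathProd_of_not_reach (hG.not_reach_of_adj hw), mul_zero]
      · rw [hΛ u w hw, zero_mul]
    · have hne : u ≠ i := by
        rintro rfl
        exact hG.not_reach_of_adj hw hi
      rw [if_neg hne, zero_add, Finset.sum_eq_single w, hG.pathProd_of_adj Λ hw hi]
      · intro y _ hy
        by_cases hadj : G.Adj u y
        · rw [pathProd_of_not_reach fun h => hy (hG.child_unique hadj hw h hi), mul_zero]
        · rw [hΛ u y hadj, zero_mul]
      · exact fun h => absurd (Finset.mem_univ w) h
  · have hne : u ≠ i := by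
      rintro rfl
      exact h (Reach.refl u)
    rw [pathProd_of_not_reach h, if_neg hne, zero_add, Finset.sum_eq_zero]
    intro w _
    by_cases hw : G.Adj u w
    · rw [pathProd_of_not_reach fun h' => h ((Reach.of_adj hw).trans h'), mul_zero]
    · rw [hΛ u w hw, zero_mul]

theorem IsPolytree.inv_one_sub [DecidableEq V] (hG : IsPolytree G) {Λ : Matrix V V R}
    (hΛ : ∀ i j, ¬ G.Adj i j → Λ i j = 0) (u i : V) :
    (1 - Λ)⁻¹ u i = pathProd G (fun e => Λ e.1 e.2) u i := by
  have h : (1 - Λ) * Matrix.of (pathProd G fun e => Λ e.1 e.2) = 1 := by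
    ext a b
    rw [sub_mul, one_mul, Matrix.sub_apply, Matrix.of_apply, Matrix.mul_apply,
      hG.pathProd_rec hΛ, Matrix.one_apply]
    simp
  rw [Matrix.inv_eq_right_inv h, Matrix.of_apply]

/-- The moment with indices `Y` in terms of the moments `ω` of the errors. -/
def trekSum (G : Digraph V) (ω : V → R) (Λ : V × V → R) (Y : Multiset V) : R :=
  ∑ a, ω a * (Y.map (pathProd G Λ a)).prod

theorem prod_pathProd_eq_zero {Λ : V × V → R} {Y : Multiset V} {a : V}
    (h : ¬ ∀ j ∈ Y, Reach G a j) : (Y.map (pathProd G Λ a)).prod = 0 := by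
  push Not at h
  obtain ⟨j, hj, hr⟩ := h
  exact Multiset.prod_eq_zero (Multiset.mem_map.2 ⟨j, hj, pathProd_of_not_reach hr Λ⟩)

theorem trekSum_eq_zero {Y : Multiset V} (h : ¬ ∃ v, ∀ j ∈ Y, Reach G v j) (ω : V → R)
    (Λ : V × V → R) : trekSum G ω Λ Y = 0 :=
  Finset.sum_eq_zero fun a _ => by
    rw [prod_pathProd_eq_zero fun h' => h ⟨a, h'⟩, mul_zero]

/-- The simple trek rule. -/
theorem IsPolytree.trekSum_eq (hG : IsPolytree G) {Y : Multiset V} (hY : Y ≠ 0) {v : V}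
    (hv : IsMeet G Y v) (ω : V → R) (Λ : V × V → R) :
    trekSum G ω Λ Y =
      (∑ a, ω a * pathProd G Λ a v ^ Y.card) * (Y.map (pathProd G Λ v)).prod := by
  rw [trekSum, Finset.sum_mul]
  refine Finset.sum_congr rfl fun a _ => ?_
  rw [mul_assoc]
  congr 1
  -- An ancestor of `v` reaches all of `Y` through `v`. Any other `a` is no common ancestor of `Y`,
  -- and both sides vanish.
  by_cases ha : Reach G a v
  · rw [← Multiset.prod_replicate, ← Multiset.map_const', ← Multiset.prod_map_mul]
    exact congrArg Multiset.prod
      (Multiset.map_congr rfl fun j hj => hG.pathProd_mul Λ ha (hv.1 j hj))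
  · rw [pathProd_of_not_reach ha, zero_pow (by simpa using hY), zero_mul,
      prod_pathProd_eq_zero fun h => ha (hv.2 a h)]

/-- The moments of the errors can be chosen such that the moments `(v, …, v)` take given values. -/
theorem IsPolytree.exists_error_moments {K : Type*} [Field K] (hG : IsPolytree G)
    (Λ : V × V → K) (k : ℕ) (hk : k ≠ 0) (c : V → K) :
    ∃ ω : V → K, ∀ v, ∑ a, ω a * pathProd G Λ a v ^ k = c v := by
  let φ : (V → K) →ₗ[K] (V → K) :=
    { toFun := fun ω v => ∑ a, ω a * pathProd G Λ a v ^ k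
      map_add' := fun ω ω' => by
        funext v
        simp [add_mul, Finset.sum_add_distrib]
      map_smul' := fun r ω => by
        funext v
        simp [Finset.mul_sum, mul_assoc] }
  -- The system is triangular along the edges with unit diagonal: strict ancestors of `v` drop out
  -- by induction, and non-ancestors have path product zero.
  have hφ : Function.Injective φ := by
    rw [← LinearMap.ker_eq_bot, LinearMap.ker_eq_bot']
    intro ω hω
    have hwf : WellFounded (Relation.TransGen G.Adj) := by
      have : IsTrans V (Relation.TransGen G.Adj) := ⟨fun _ _ _ => Relation.TransGen.trans⟩
      have : Std.Irrefl (Relation.TransGen G.Adj) := ⟨hG.1⟩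
      exact Finite.wellFounded_of_trans_of_irrefl _
    funext v
    induction v using hwf.induction with
    | _ v ih =>
      have h : ∑ a, ω a * pathProd G Λ a v ^ k = 0 := congrFun hω v
      rw [Finset.sum_eq_single v, hG.pathProd_self, one_pow, mul_one] at h
      · exact h
      · intro a _ hne
        by_cases ha : Reach G a v
        · obtain h | h := Relation.reflTransGen_iff_eq_or_transGen.1 ha
          · exact absurd h.symm hne
          · rw [ih a h]
            simp
        · rw [pathProd_of_not_reach ha, zero_pow hk, mul_zero]
      · exact fun h => absurd (Finset.mem_univ v) h
  obtain ⟨ω, hω⟩ := LinearMap.injective_iff_surjective.1 hφ c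
  exact ⟨ω, fun v => congrFun hω v⟩

end PathProd

/-! ### The points of the model -/

/-- The indices of a variable. -/
def sinks : MomentVar V → Multiset V := Sum.elim Sym2.toMultiset Sym.toMultiset

@[simp]
theorem sinks_sIdx (i j : V) : sinks (sIdx i j) = i ::ₘ {j} := rfl

@[simp]
theorem sinks_tIdx (i j k : V) : sinks (tIdx i j k) = i ::ₘ j ::ₘ {k} := rfl

theorem momentVar_cases (x : MomentVar V) :
    (∃ i j, x = sIdx i j) ∨ ∃ i j k, x = tIdx i j k := by
  obtain x | x := x
  · induction x with | _ i j => exact Or.inl ⟨i, j, rfl⟩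
  · obtain ⟨i, j, k, h⟩ := Multiset.card_eq_three.1 x.2
    exact Or.inr ⟨i, j, k, congrArg Sum.inr (Subtype.ext h)⟩

theorem card_sinks (x : MomentVar V) :
    (sinks x).card = Sum.elim (fun _ => 2) (fun _ => 3) x := by
  obtain ⟨i, j, rfl⟩ | ⟨i, j, k, rfl⟩ := momentVar_cases x <;> rfl

theorem sinks_ne_zero (x : MomentVar V) : sinks x ≠ 0 := by
  obtain ⟨i, j, rfl⟩ | ⟨i, j, k, rfl⟩ := momentVar_cases x <;> simp

theorem sinks_injective : Function.Injective (sinks (V := V)) := by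
  rintro (x | x) (y | y) h
  · refine congrArg Sum.inl (Sym2.ext fun a => ?_)
    rw [← Sym2.mem_toMultiset, ← Sym2.mem_toMultiset, show x.toMultiset = y.toMultiset from h]
  · have := congrArg Multiset.card h
    simp [card_sinks] at this
  · have := congrArg Multiset.card h
    simp [card_sinks] at this
  · exact congrArg Sum.inr (Subtype.ext h)

section Points

variable [Fintype V] {R : Type*} [CommRing R]

/-- The point with error moments `ω₂` and `ω₃` and edge weights `Λ`. -/
def momentPoint (G : Digraph V) (ω₂ ω₃ : V → R) (Λ : V × V → R) (x : MomentVar V) : R :=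
  trekSum G (Sum.elim (fun _ => ω₂) (fun _ => ω₃) x) Λ (sinks x)

theorem map_momentPoint {S : Type*} [CommRing S] (φ : R →+* S) (ω₂ ω₃ : V → R)
    (Λ : V × V → R) (x : MomentVar V) :
    φ (momentPoint G ω₂ ω₃ Λ x) = momentPoint G (φ ∘ ω₂) (φ ∘ ω₃) (φ ∘ Λ) x := by
  simp only [momentPoint, trekSum, map_sum, map_mul, map_multiset_prod, Multiset.map_map,
    Function.comp_def, map_pathProd]
  cases x <;> rfl

theorem momentPoint_sIdx (ω₂ ω₃ : V → R) (Λ : V × V → R) (i j : V) :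
    momentPoint G ω₂ ω₃ Λ (sIdx i j) =
      ∑ a, ω₂ a * (pathProd G Λ a i * pathProd G Λ a j) := by
  simp only [momentPoint, trekSum, sinks_sIdx, Multiset.map_cons, Multiset.map_singleton,
    Multiset.prod_cons, Multiset.prod_singleton]
  rfl

theorem momentPoint_tIdx (ω₂ ω₃ : V → R) (Λ : V × V → R) (i j k : V) :
    momentPoint G ω₂ ω₃ Λ (tIdx i j k) =
      ∑ a, ω₃ a * (pathProd G Λ a i * (pathProd G Λ a j * pathProd G Λ a k)) := by
  simp only [momentPoint, trekSum, sinks_tIdx, Multiset.map_cons, Multiset.map_singleton,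
    Multiset.prod_cons, Multiset.prod_singleton]
  rfl

theorem IsPolytree.covariance_eq [DecidableEq V] (hG : IsPolytree G) {Λ : Matrix V V R}
    (hΛ : ∀ i j, ¬ G.Adj i j → Λ i j = 0) (ω₂ ω₃ : V → R) (i j : V) :
    (((1 - Λ)⁻¹).transpose * Matrix.diagonal ω₂ * (1 - Λ)⁻¹) i j =
      momentPoint G ω₂ ω₃ (fun e => Λ e.1 e.2) (sIdx i j) := by
  rw [momentPoint_sIdx, Matrix.mul_apply]
  refine Finset.sum_congr rfl fun a _ => ?_
  rw [Matrix.mul_diagonal, Matrix.transpose_apply, hG.inv_one_sub hΛ, hG.inv_one_sub hΛ]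
  ring

theorem IsPolytree.tucker_eq [DecidableEq V] (hG : IsPolytree G) {Λ : Matrix V V ℝ}
    (hΛ : ∀ i j, ¬ G.Adj i j → Λ i j = 0) (ω₂ ω₃ : V → ℝ) (i j k : V) :
    tucker (diagTensor ω₃) (1 - Λ)⁻¹ i j k =
      momentPoint G ω₂ ω₃ (fun e => Λ e.1 e.2) (tIdx i j k) := by
  rw [momentPoint_tIdx]
  simp [tucker, diagTensor, ite_and, Finset.sum_ite_eq, ite_mul, mul_assoc, hG.inv_one_sub hΛ]

theorem momentPoint_ofReal (ω₂ ω₃ : V → ℝ) (Λ : V × V → ℝ) (x : MomentVar V) :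
    ((momentPoint G ω₂ ω₃ Λ x : ℝ) : ℂ) =
      momentPoint G (fun v => (ω₂ v : ℂ)) (fun v => (ω₃ v : ℂ)) (fun e => (Λ e : ℂ)) x :=
  map_momentPoint Complex.ofRealHom ω₂ ω₃ Λ x

theorem IsPolytree.exists_of_mem_modelPoints [DecidableEq V] (hG : IsPolytree G)
    {x : MomentVar V → ℂ} (hx : x ∈ modelPoints G) :
    ∃ (ω₂ ω₃ : V → ℂ) (Λ : V × V → ℂ), x = momentPoint G ω₂ ω₃ Λ := by
  obtain ⟨p, ⟨Λ, ω₂, ω₃, hΛ, -, h₁, h₂⟩, h₃, h₄⟩ := hx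
  refine ⟨fun v => ω₂ v, fun v => ω₃ v, fun e => Λ e.1 e.2, ?_⟩
  funext y
  rw [← momentPoint_ofReal ω₂ ω₃ fun e => Λ e.1 e.2]
  obtain ⟨i, j, rfl⟩ | ⟨i, j, k, rfl⟩ := momentVar_cases y
  · rw [h₃, h₁, hG.covariance_eq hΛ ω₂ ω₃]
  · rw [h₄, h₂, hG.tucker_eq hΛ ω₂ ω₃]

theorem IsPolytree.momentPoint_mem_modelPoints [DecidableEq V] (hG : IsPolytree G)
    {ω₂ : V → ℝ} (hω₂ : ∀ i, 0 < ω₂ i) (ω₃ : V → ℝ) (Λ : V × V → ℝ) :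
    momentPoint G (fun v => (ω₂ v : ℂ)) (fun v => (ω₃ v : ℂ)) (fun e => (Λ e : ℂ)) ∈
      modelPoints G := by
  classical
  let Λ' : Matrix V V ℝ := Matrix.of fun i j => if G.Adj i j then Λ (i, j) else 0
  have hΛ' : ∀ i j, ¬ G.Adj i j → Λ' i j = 0 := fun i j h => if_neg h
  have e : momentPoint G ω₂ ω₃ Λ = momentPoint G ω₂ ω₃ fun e => Λ' e.1 e.2 := by
    funext x
    unfold momentPoint trekSum
    rw [pathProd_congr (Λ' := fun e => Λ' e.1 e.2) fun u w h =>
      (if_pos h : Λ' u w = Λ (u, w)).symm]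
  refine ⟨⟨((1 - Λ')⁻¹).transpose * Matrix.diagonal ω₂ * (1 - Λ')⁻¹,
    tucker (diagTensor ω₃) (1 - Λ')⁻¹⟩, ⟨Λ', ω₂, ω₃, hΛ', hω₂, rfl, rfl⟩,
    fun i j => ?_, fun i j k => ?_⟩
  · rw [← momentPoint_ofReal, e]
    exact congrArg _ (hG.covariance_eq hΛ' ω₂ ω₃ i j).symm
  · rw [← momentPoint_ofReal, e]
    exact congrArg _ (hG.tucker_eq hΛ' ω₂ ω₃ i j k).symm

/-! ### The monomial parametrization -/

/-- The parameters: the moments `(v, v)` and `(v, v, v)` and the edge weights. -/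
abbrev ParamVar (V : Type*) := (V ⊕ V) ⊕ V × V

/-- A polynomial that vanishes on the model also vanishes for complex parameters. -/
theorem IsPolytree.aeval_momentPoint_eq_zero [DecidableEq V] (hG : IsPolytree G)
    {f : MomentRing V} (hf : f ∈ momentIdeal G) (ω₂ ω₃ : V → ℂ) (Λ : V × V → ℂ) :
    aeval (momentPoint G ω₂ ω₃ Λ) f = 0 := by
  let F : MvPolynomial (ParamVar V) ℂ := aeval (momentPoint G (fun v => X (Sum.inl (Sum.inl v)))
    (fun v => X (Sum.inl (Sum.inr v))) (fun e => X (Sum.inr e))) f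
  have hF : ∀ θ : ParamVar V → ℂ, eval θ F = aeval (momentPoint G
      (fun v => θ (Sum.inl (Sum.inl v))) (fun v => θ (Sum.inl (Sum.inr v)))
      (fun e => θ (Sum.inr e))) f := by
    intro θ
    rw [← coe_aeval_eq_eval, RingHom.coe_coe, ← AlgHom.comp_apply, comp_aeval]
    congr 2
    funext x
    refine (map_momentPoint (aeval θ : MvPolynomial (ParamVar V) ℂ →ₐ[ℂ] ℂ).toRingHom
      _ _ _ x).trans ?_
    simp [Function.comp_def]
  -- The polynomial `F` vanishes on a product of infinite sets: the positive reals for the second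
  -- moments, the reals for the other parameters.
  have hF0 : F = 0 := by
    refine funext_set (fun p => Complex.ofReal '' Sum.elim (Sum.elim (fun _ => Set.Ioi 0)
      fun _ => Set.univ) (fun _ => Set.univ) p) ?_ fun θ hθ => ?_
    · rintro ((v | v) | e)
      · exact (Set.Ioi_infinite 0).image Complex.ofReal_injective.injOn
      · exact Set.infinite_univ.image Complex.ofReal_injective.injOn
      · exact Set.infinite_univ.image Complex.ofReal_injective.injOn
    · choose r hr hrθ using fun p => hθ p (Set.mem_univ p)
      obtain rfl : (fun p => (r p : ℂ)) = θ := funext hrθ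
      rw [hF, map_zero]
      exact hf _ (hG.momentPoint_mem_modelPoints (ω₂ := fun v => r (Sum.inl (Sum.inl v)))
        (fun v => hr (Sum.inl (Sum.inl v))) (fun v => r (Sum.inl (Sum.inr v)))
        (fun e => r (Sum.inr e)))
  have := hF (Sum.elim (Sum.elim ω₂ ω₃) Λ)
  rw [hF0, map_zero] at this
  exact this.symm

/-- The vertex `v` as index of the moment `(v, v)` or `(v, v, v)`. -/
def topParam (x : MomentVar V) (v : V) : ParamVar V :=
  Sum.inl (Sum.elim (fun _ => Sum.inl v) (fun _ => Sum.inr v) x)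

/-- The image of a variable under the monomial parametrization, where `v` is the top of its
trek. -/
def trekMonomial (G : Digraph V) (x : MomentVar V) (v : V) : MvPolynomial (ParamVar V) ℂ :=
  X (topParam x v) * ((sinks x).map (pathProd G (fun e => X (Sum.inr e)) v)).prod

open scoped Classical in
/-- The monomial parametrization. -/
def trekParam (G : Digraph V) (x : MomentVar V) : MvPolynomial (ParamVar V) ℂ :=
  if h : ∃ v, IsMeet G (sinks x) v then trekMonomial G x h.choose else 0

theorem IsPolytree.trekParam_of_isMeet (hG : IsPolytree G) {x : MomentVar V} {v : V}
    (h : IsMeet G (sinks x) v) : trekParam G x = trekMonomial G x v := by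
  have h' : ∃ v, IsMeet G (sinks x) v := ⟨v, h⟩
  rw [trekParam, dif_pos h', h'.choose_spec.unique hG h]

theorem trekParam_eq_zero {x : MomentVar V} (h : ¬ ∃ v, IsMeet G (sinks x) v) :
    trekParam G x = 0 := dif_neg h

/-- Every value of the monomial parametrization is a complex moment point, as the error moments can
be solved for from prescribed moments (v, v) and (v, v, v). -/
theorem IsPolytree.aeval_trekParam_eq_zero [DecidableEq V] (hG : IsPolytree G)
    {f : MomentRing V} (hf : f ∈ momentIdeal G) : aeval (trekParam G) f = 0 := by
  refine MvPolynomial.funext fun θ => ?_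
  obtain ⟨ω₂, h₂⟩ := hG.exists_error_moments (fun e => θ (Sum.inr e)) 2 two_ne_zero
    fun v => θ (Sum.inl (Sum.inl v))
  obtain ⟨ω₃, h₃⟩ := hG.exists_error_moments (fun e => θ (Sum.inr e)) 3 three_ne_zero
    fun v => θ (Sum.inl (Sum.inr v))
  rw [map_zero, ← hG.aeval_momentPoint_eq_zero hf ω₂ ω₃ fun e => θ (Sum.inr e),
    ← coe_aeval_eq_eval, RingHom.coe_coe, ← AlgHom.comp_apply, comp_aeval]
  congr 2
  funext x
  by_cases h : ∃ v, IsMeet G (sinks x) v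
  · obtain ⟨v, hv⟩ := h
    rw [hG.trekParam_of_isMeet hv, momentPoint,
      hG.trekSum_eq (sinks_ne_zero x) hv, card_sinks, trekMonomial, map_mul, map_multiset_prod,
      Multiset.map_map]
    congr 1
    · obtain x | x := x
      · simpa [topParam] using (h₂ v).symm
      · simpa [topParam] using (h₃ v).symm
    · congr 2
      funext j
      refine (map_pathProd (aeval θ : MvPolynomial (ParamVar V) ℂ →ₐ[ℂ] ℂ).toRingHom
        _ v j).trans ?_
      simp [Function.comp_def]
  · rw [trekParam_eq_zero h, map_zero, momentPoint, trekSum_eq_zero]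
    rintro ⟨v, hv⟩
    exact h (hG.exists_isMeet (sinks_ne_zero x) hv)

end Points

/-! ### Columns of the trek-matrices -/

/-- The index of the entry in the row of `i` and the column `c` of a trek-matrix. -/
def colIdx {a b : V} (i : V) (c : TrekCol G a b) : MomentVar V :=
  Sum.elim (fun k => sIdx i k.1) (fun q => tIdx i q.1.1 q.1.2) c

/-- The vertices that index the column `c` of a trek-matrix. -/
def colSinks {a b : V} (c : TrekCol G a b) : Multiset V :=
  Sum.elim (fun k => {k.1}) (fun q => q.1.1 ::ₘ {q.1.2}) c

theorem sinks_colIdx {a b : V} (i : V) (c : TrekCol G a b) :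
    sinks (colIdx i c) = i ::ₘ colSinks c := by
  obtain k | q := c <;> rfl

theorem trekMatrix_apply (i j : V) (r : Fin 2) (c : TrekCol G i j) :
    trekMatrix G i j r c = X (colIdx (![i, j] r) c) := by
  obtain k | q := c <;> rfl

theorem IsPolytree.exists_isMeet_col (hG : IsPolytree G) {i j : V} (c : TrekCol G i j) :
    ∃ v, IsMeet G (i ::ₘ colSinks c) v ∧ IsMeet G (j ::ₘ colSinks c) v := by
  obtain ⟨k, v, h₁, h₂⟩ | ⟨q, v, h₁, h₂⟩ := c
  · exact ⟨v, h₁.isMeet hG, h₂.isMeet hG⟩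
  · exact ⟨v, h₁.isMeet hG, h₂.isMeet hG⟩

/-- The proportionality of the two entries of a column of a trek-matrix. -/
theorem IsPolytree.exists_factor [Fintype V] {R : Type*} [CommRing R] (hG : IsPolytree G)
    (ω₂ ω₃ : V → R) (Λ : V × V → R) {i j : V} (c : TrekCol G i j) :
    ∃ v κ, Reach G v i ∧ Reach G v j ∧
      momentPoint G ω₂ ω₃ Λ (colIdx i c) = κ * pathProd G Λ v i ∧
      momentPoint G ω₂ ω₃ Λ (colIdx j c) = κ * pathProd G Λ v j := by
  obtain ⟨v, hi, hj⟩ := hG.exists_isMeet_col c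
  let ω : V → R := Sum.elim (fun _ => ω₂) (fun _ => ω₃) c
  have hω : ∀ l, Sum.elim (fun _ => ω₂) (fun _ => ω₃) (colIdx l c) = ω := by
    intro l
    obtain k | q := c <;> rfl
  have key : ∀ l, IsMeet G (l ::ₘ colSinks c) v → momentPoint G ω₂ ω₃ Λ (colIdx l c) =
      (∑ a, ω a * pathProd G Λ a v ^ ((colSinks c).card + 1)) *
        ((colSinks c).map (pathProd G Λ v)).prod * pathProd G Λ v l := by
    intro l hl
    rw [momentPoint, hω, sinks_colIdx, hG.trekSum_eq (Multiset.cons_ne_zero) hl,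
      Multiset.card_cons, Multiset.map_cons, Multiset.prod_cons]
    ring
  exact ⟨v, _, hi.1 i (Multiset.mem_cons_self _ _), hj.1 j (Multiset.mem_cons_self _ _),
    key i hi, key j hj⟩

/-- All four paths pass the least common descendant of `u` and `v`, and both sides split into the
same four factors there. -/
theorem IsPolytree.pathProd_exchange [Fintype V] {R : Type*} [CommRing R] (hG : IsPolytree G)
    (Λ : V × V → R) {u v i j : V} (hui : Reach G u i) (huj : Reach G u j) (hvi : Reach G v i)
    (hvj : Reach G v j) :
    pathProd G Λ u i * pathProd G Λ v j = pathProd G Λ v i * pathProd G Λ u j := by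
  obtain ⟨z, h₁, h₂, h₃⟩ := hG.exists_sup hui hvi
  have hi := h₃ i hui hvi
  have hj := h₃ j huj hvj
  rw [hG.pathProd_mul Λ h₁ hi, hG.pathProd_mul Λ h₁ hj, hG.pathProd_mul Λ h₂ hi,
    hG.pathProd_mul Λ h₂ hj]
  ring

theorem map_univ_two (i j : V) : Finset.univ.val.map ![i, j] = i ::ₘ {j} := rfl

theorem map_univ_three (i j k : V) : Finset.univ.val.map ![i, j, k] = i ::ₘ j ::ₘ {k} := rfl

/-- The proposed generators vanish on the model. -/
theorem IsPolytree.generators_subset_momentIdeal [Fintype V] [DecidableEq V] (hG : IsPolytree G)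
    (O : Set V) : observedMinors G O ∪ observedLinear G O ⊆ (momentIdeal G : Set _) := by
  intro f hf x hx
  obtain ⟨ω₂, ω₃, Λ, rfl⟩ := hG.exists_of_mem_modelPoints hx
  obtain ⟨i, -, j, -, -, c, d, rfl⟩ | ⟨i, -, j, -, h, rfl⟩ | ⟨i, -, j, -, k, -, h, rfl⟩ := hf
  · rw [Matrix.det_fin_two]
    simp only [observedTrekMatrix, Matrix.submatrix_apply, trekMatrix_apply, id, map_sub, map_mul,
      aeval_X, Matrix.cons_val_zero, Matrix.cons_val_one]
    obtain ⟨u, κ, hui, huj, h₁, h₂⟩ := hG.exists_factor ω₂ ω₃ Λ c.1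
    obtain ⟨v, μ, hvi, hvj, h₃, h₄⟩ := hG.exists_factor ω₂ ω₃ Λ d.1
    rw [h₁, h₂, h₃, h₄]
    linear_combination κ * μ * hG.pathProd_exchange Λ hui huj hvi hvj
  · rw [sVar, aeval_X, momentPoint, trekSum_eq_zero]
    rw [sinks_sIdx, ← map_univ_two, ← nonempty_trek_iff]
    exact not_nonempty_iff.2 h
  · rw [tVar, aeval_X, momentPoint, trekSum_eq_zero]
    rw [sinks_tIdx, ← map_univ_three, ← nonempty_trek_iff]
    exact not_nonempty_iff.2 h

/-! ### The exchange relations in the quotient -/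

theorem mem_observedVars_iff {O : Set V} {x : MomentVar V} :
    x ∈ observedVars O ↔ ∀ j ∈ sinks x, j ∈ O := by
  constructor
  · rintro (⟨i, hi, j, hj, rfl⟩ | ⟨i, hi, j, hj, k, hk, rfl⟩) <;> simp [*]
  · intro h
    obtain ⟨i, j, rfl⟩ | ⟨i, j, k, rfl⟩ := momentVar_cases x
    · exact Or.inl ⟨i, h i (by simp), j, h j (by simp), rfl⟩
    · exact Or.inr ⟨i, h i (by simp), j, h j (by simp), k, h k (by simp), rfl⟩

/-- The ideal generated by the minors and the linear forms. -/
def generatedIdeal (G : Digraph V) (O : Set V) : Ideal (observedRing O) :=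
  Ideal.span {f : observedRing O | (f : MomentRing V) ∈ observedMinors G O ∪ observedLinear G O}

/-- The class of an observed variable modulo the generators. -/
def varClass (G : Digraph V) (O : Set V) (x : observedVars O) :
    observedRing O ⧸ generatedIdeal G O :=
  Ideal.Quotient.mk _ ⟨X x.1, X_mem_supported.2 x.2⟩

open scoped Classical in
/-- The class of the variable that belongs to a trek. -/
def trekClass (G : Digraph V) (O : Set V) (t : V × Multiset V) :
    observedRing O ⧸ generatedIdeal G O :=
  if h : ∃ x : observedVars O, sinks x.1 = t.2 then varClass G O h.choose else 0

theorem trekClass_sinks {O : Set V} (x : observedVars O) (v : V) :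
    trekClass G O (v, sinks x.1) = varClass G O x := by
  have h : ∃ y : observedVars O, sinks y.1 = sinks x.1 := ⟨x, rfl⟩
  rw [trekClass, dif_pos h]
  exact congrArg _ (Subtype.ext (sinks_injective h.choose_spec))

/-- Two simple treks with the same top that differ in one sink are the two entries of one column, so
the exchange relations are exactly observed minors. -/
theorem exists_observedCol {O : Set V} {i j τ : V} {X : Multiset V}
    (hi : IsObservedTrek G O (τ, i ::ₘ X)) (hj : IsObservedTrek G O (τ, j ::ₘ X)) :
    ∃ c : {c : TrekCol G i j // IsObservedCol O c}, colSinks c.1 = X := by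
  have hO : ∀ k ∈ X, k ∈ O := fun k hk => hi.mem k (Multiset.mem_cons_of_mem hk)
  have hc := hi.card
  simp only [Multiset.card_cons, Nat.reduceEqDiff] at hc
  obtain hc | hc := hc
  · obtain ⟨k, rfl⟩ := Multiset.card_eq_one.1 hc
    exact ⟨⟨Sum.inl ⟨k, τ, hi.branches.isTop, hj.branches.isTop⟩, hO k (by simp)⟩, rfl⟩
  · obtain ⟨l, m, rfl⟩ := Multiset.card_eq_two.1 hc
    exact ⟨⟨Sum.inr ⟨(l, m), τ, Branches.isTop (i := ![i, l, m]) hi.branches,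
      Branches.isTop (i := ![j, l, m]) hj.branches⟩, hO l (by simp), hO m (by simp)⟩, rfl⟩

theorem exchangeRelations_trekClass (O : Set V) : ExchangeRelations G O (trekClass G O) := by
  intro τ ρ i j X Y h₁ h₂ h₃ h₄
  obtain ⟨c, rfl⟩ := exists_observedCol h₁ h₂
  obtain ⟨d, rfl⟩ := exists_observedCol h₄ h₃
  have hi : i ∈ O := h₁.mem i (Multiset.mem_cons_self _ _)
  have hj : j ∈ O := h₂.mem j (Multiset.mem_cons_self _ _)
  have htrek : Nonempty (Trek G ![i, j]) := by
    rw [nonempty_trek_iff]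
    refine ⟨τ, forall_mem_map_univ.2 fun r => ?_⟩
    fin_cases r
    · exact h₁.branches.1 i (Multiset.mem_cons_self _ _)
    · exact h₂.branches.1 j (Multiset.mem_cons_self _ _)
  have hmem : ∀ l ∈ O, ∀ c : {c : TrekCol G i j // IsObservedCol O c},
      colIdx l c.1 ∈ observedVars O := by
    rintro l hl ⟨k | q, hc⟩
    · exact Or.inl ⟨l, hl, k.1, hc, rfl⟩
    · exact Or.inr ⟨l, hl, _, hc.1, _, hc.2, rfl⟩
  have hclass : ∀ (v l : V) (hl : l ∈ O) (c : {c : TrekCol G i j // IsObservedCol O c}),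
      trekClass G O (v, l ::ₘ colSinks c.1) = varClass G O ⟨colIdx l c.1, hmem l hl c⟩ := by
    intro v l hl c
    rw [← sinks_colIdx]
    exact trekClass_sinks ⟨colIdx l c.1, hmem l hl c⟩ v
  rw [hclass τ i hi c, hclass ρ j hj d, hclass τ j hj c, hclass ρ i hi d, ← sub_eq_zero]
  unfold varClass
  rw [← map_mul, ← map_mul, ← map_sub, Ideal.Quotient.eq_zero_iff_mem]
  refine Ideal.subset_span (Or.inl ⟨i, hi, j, hj, htrek, c, d, ?_⟩)
  rw [Matrix.det_fin_two]
  simp only [observedTrekMatrix, Matrix.submatrix_apply, trekMatrix_apply, id,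
    Matrix.cons_val_zero, Matrix.cons_val_one]
  rw [mul_comm (X (colIdx i d.1))]
  rfl

/-- Any common ancestor of the indices would yield a greatest one. Hence there is no trek, and the
variable is one of the linear generators. -/
theorem IsPolytree.varClass_eq_zero [Finite V] (hG : IsPolytree G) {O : Set V}
    (x : observedVars O) (h : ¬ ∃ v, IsMeet G (sinks x.1) v) : varClass G O x = 0 := by
  have hno : ¬ ∃ v, ∀ j ∈ sinks x.1, Reach G v j := fun ⟨v, hv⟩ =>
    h (hG.exists_isMeet (sinks_ne_zero _) hv)
  rw [varClass, Ideal.Quotient.eq_zero_iff_mem]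
  refine Ideal.subset_span (Or.inr ?_)
  obtain ⟨_, ⟨i, hi, j, hj, rfl⟩ | ⟨i, hi, j, hj, k, hk, rfl⟩⟩ := x
  · refine Or.inl ⟨i, hi, j, hj, ?_, rfl⟩
    rw [← not_nonempty_iff, nonempty_trek_iff]
    exact hno
  · refine Or.inr ⟨i, hi, j, hj, k, hk, ?_, rfl⟩
    rw [← not_nonempty_iff, nonempty_trek_iff]
    exact hno

/-! ### Exponents of the monomial parametrization -/

section Exponents

variable [Fintype V]

/-- The exponent of `trekMonomial G x v`. -/
def trekExponent (G : Digraph V) (x : MomentVar V) (v : V) : ParamVar V →₀ ℕ :=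
  Finsupp.single (topParam x v) 1 +
    ((sinks x).map fun j => ∑ e ∈ pathEdges G v j, Finsupp.single (Sum.inr e) 1).sum

theorem trekMonomial_eq {x : MomentVar V} {v : V} (h : ∀ j ∈ sinks x, Reach G v j) :
    trekMonomial G x v = monomial (trekExponent G x v) 1 := by
  have key : ∀ Y : Multiset V, (∀ j ∈ Y, Reach G v j) →
      (Y.map (pathProd G (fun e => (X (Sum.inr e) : MvPolynomial (ParamVar V) ℂ)) v)).prod =
        monomial (Y.map fun j => ∑ e ∈ pathEdges G v j,
          (Finsupp.single (Sum.inr e) 1 : ParamVar V →₀ ℕ)).sum 1 := by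
    intro Y
    induction Y using Multiset.induction with
    | empty =>
      intro _
      simp
    | cons j Y ih =>
      intro hY
      rw [Multiset.map_cons, Multiset.prod_cons, Multiset.map_cons, Multiset.sum_cons,
        ih fun c hc => hY c (Multiset.mem_cons_of_mem hc),
        pathProd_of_reach (hY j (Multiset.mem_cons_self _ _)), ← one_mul (1 : ℂ),
        ← monomial_mul, one_mul, monomial_sum_one]
      rfl
  rw [trekMonomial, key _ h, trekExponent, ← one_mul (1 : ℂ), ← monomial_mul, one_mul]
  rfl

/-- Any weighting `g` of the parameters extends additively to exponents; suitable weightings read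
off the tops and steps. -/
theorem liftAddHom_trekExponent {N : Type*} [AddCommMonoid N] (g : ParamVar V → N)
    (x : MomentVar V) (v : V) :
    Finsupp.liftAddHom (fun p => multiplesHom N (g p)) (trekExponent G x v) =
      g (topParam x v) + ((sinks x).map fun j => ∑ e ∈ pathEdges G v j, g (Sum.inr e)).sum := by
  rw [trekExponent, map_add, map_multiset_sum, Multiset.map_map]
  simp only [Function.comp_def, map_sum, Finsupp.liftAddHom_apply_single, multiplesHom_apply,
    one_smul]

/-- Telescoping along the path: edges into `w` minus edges out of `w`. -/
theorem IsPolytree.sum_pathEdges_sub [DecidableEq V] (hG : IsPolytree G) {v j : V}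
    (h : Reach G v j) (w : V) :
    ∑ e ∈ pathEdges G v j, ((if e.2 = w then 1 else 0) - (if e.1 = w then 1 else 0) : ℤ) =
      (if j = w then 1 else 0) - (if v = w then 1 else 0) := by
  induction h using Relation.ReflTransGen.head_induction_on with
  | refl => rw [hG.pathEdges_self, Finset.sum_empty, sub_self]
  | head h hr ih =>
    rw [hG.pathEdges_of_adj h hr, Finset.sum_insert (hG.notMem_pathEdges h j), ih]
    ring

/-- Flow conservation at `y`. The step from `y` to itself means ending there, so `stepCount G y y`
counts the sinks equal to `y`, which no single parameter records. -/
theorem IsPolytree.sum_sub_eq_stepCount [DecidableEq V] (hG : IsPolytree G) {v : V}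
    {Y : Multiset V} (hY : ∀ j ∈ Y, Reach G v j) (y : V) :
    (Y.map fun j => ∑ e ∈ pathEdges G v j,
      ((if e.2 = y then 1 else 0) - (if e.1 = y then 1 else 0) : ℤ)).sum =
        (stepCount G y y (v, Y) : ℤ) - Y.card * (if v = y then 1 else 0) := by
  classical
  induction Y using Multiset.induction with
  | empty => simp [stepCount]
  | cons j Y ih =>
    have hj := hY j (Multiset.mem_cons_self _ _)
    have hstep : (Reach G v y ∧ Step G y y j) ↔ j = y := by
      constructor
      · rintro ⟨-, ⟨-, h⟩ | ⟨h, -⟩⟩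
        · exact h
        · exact absurd rfl (hG.ne_of_adj h)
      · rintro rfl
        exact ⟨hj, Or.inl ⟨rfl, rfl⟩⟩
    have e : stepCount G y y (v, j ::ₘ Y) =
        stepCount G y y (v, Y) + if j = y then 1 else 0 := by
      rw [stepCount, Multiset.countP_cons, stepCount]
      simp only [hstep]
    rw [Multiset.map_cons, Multiset.sum_cons, hG.sum_pathEdges_sub hj,
      ih fun c hc => hY c (Multiset.mem_cons_of_mem hc), e, Multiset.card_cons]
    push_cast
    ring

/-- Additive functions of the exponents are determined by the sum of the exponents. -/
theorem sum_map_eq_of_exponents {N : Type*} [AddCommMonoid N]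
    {m m' : Multiset (MomentVar V × V)} (hm : ∀ p ∈ m, IsMeet G (sinks p.1) p.2)
    (hm' : ∀ p ∈ m', IsMeet G (sinks p.1) p.2)
    (h : (m.map fun p => trekExponent G p.1 p.2).sum =
      (m'.map fun p => trekExponent G p.1 p.2).sum)
    (g : ParamVar V → N) (F : V × Multiset V → N)
    (hF : ∀ x v, IsMeet G (sinks x) v → g (topParam x v) +
      ((sinks x).map fun j => ∑ e ∈ pathEdges G v j, g (Sum.inr e)).sum = F (v, sinks x)) :
    ((m.map fun p => (p.2, sinks p.1)).map F).sum =
      ((m'.map fun p => (p.2, sinks p.1)).map F).sum := by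
  have h' := congrArg (Finsupp.liftAddHom fun p => multiplesHom N (g p)) h
  rw [map_multiset_sum, map_multiset_sum, Multiset.map_map, Multiset.map_map] at h'
  rw [Multiset.map_map, Multiset.map_map]
  convert h' using 2
  · refine Multiset.map_congr rfl fun p hp => ?_
    rw [Function.comp_apply, Function.comp_apply, liftAddHom_trekExponent, hF _ _ (hm p hp)]
  · refine Multiset.map_congr rfl fun p hp => ?_
    rw [Function.comp_apply, Function.comp_apply, liftAddHom_trekExponent, hF _ _ (hm' p hp)]

/-- The exponents determine the steps. -/
theorem IsPolytree.sameSteps_of_exponents (hG : IsPolytree G)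
    {m m' : Multiset (MomentVar V × V)} (hm : ∀ p ∈ m, IsMeet G (sinks p.1) p.2)
    (hm' : ∀ p ∈ m', IsMeet G (sinks p.1) p.2)
    (h : (m.map fun p => trekExponent G p.1 p.2).sum =
      (m'.map fun p => trekExponent G p.1 p.2).sum) :
    SameSteps G (m.map fun p => (p.2, sinks p.1)) (m'.map fun p => (p.2, sinks p.1)) := by
  classical
  refine ⟨?_, fun w y => ?_⟩
  · have := sum_map_eq_of_exponents hm hm' h (Sum.elim (Sum.elim (fun v => {(2, v)})
      fun v => {(3, v)}) fun _ => 0) (fun t => ({(t.2.card, t.1)} : Multiset (ℕ × V)))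
      fun x v _ => by
        rw [card_sinks]
        obtain x | x := x <;> simp [topParam]
    have e : ∀ M : Multiset (V × Multiset V),
        (M.map fun t => ({(t.2.card, t.1)} : Multiset (ℕ × V))).sum =
          M.map fun t => (t.2.card, t.1) := fun M => by
      refine Eq.trans ?_ (Multiset.sum_map_singleton _)
      rw [Multiset.map_map]
      rfl
    rwa [e, e] at this
  · by_cases hwy : y = w
    · subst hwy
      -- The weights 2 and 3 compensate for the paths that start at the top `y`, one for each sink
      -- of the trek.
      have := sum_map_eq_of_exponents hm hm' h (Sum.elim (Sum.elim (fun v => if v = y then 2 else 0)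
        fun v => if v = y then 3 else 0)
        fun e => (if e.2 = y then 1 else 0) - (if e.1 = y then 1 else 0))
        (fun t => (stepCount G y y t : ℤ)) fun x v hv => by
          have e₁ := hG.sum_sub_eq_stepCount hv.1 y
          rw [card_sinks] at e₁
          simp only [Sum.elim_inr, e₁]
          obtain x | x := x <;> by_cases hvy : v = y <;> simp [topParam, hvy]
      have e : ∀ M : Multiset (V × Multiset V), ((M.map (stepCount G y y)).sum : ℤ) =
          (M.map fun t => (stepCount G y y t : ℤ)).sum := fun M => by
        refine (map_multiset_sum (Nat.castRingHom ℤ) _).trans ?_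
        rw [Multiset.map_map]
        rfl
      rw [← e, ← e] at this
      exact_mod_cast this
    · refine sum_map_eq_of_exponents hm hm' h
        (Sum.elim (fun _ => 0) fun e => if e = (w, y) then 1 else 0) _ fun x v _ => ?_
      rw [topParam, Sum.elim_inl, zero_add, stepCount]
      simp only [Sum.elim_inr, Finset.sum_ite_eq']
      generalize sinks x = Y
      have : ∀ j, (w, y) ∈ pathEdges G v j ↔ Reach G v w ∧ Step G w y j := by
        intro j
        simp only [mem_pathEdges, Step, hwy, false_and, false_or]
        tauto
      simp only [this]
      induction Y using Multiset.induction with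
      | empty => simp
      | cons j Y ih => rw [Multiset.map_cons, Multiset.sum_cons, ih, Multiset.countP_cons, add_comm]

end Exponents

/-! ### Kernels of monomial maps -/

theorem aeval_monomial_one {σ K A : Type*} [CommRing K] [CommRing A] [Algebra K A] (f : σ → A)
    (s : σ →₀ ℕ) : aeval f (monomial s (1 : K)) = (s.toMultiset.map f).prod := by
  classical
  rw [aeval_monomial, map_one, one_mul, Finset.prod_multiset_map_count,
    Finsupp.toFinset_toMultiset]
  simp [Finsupp.prod, Finsupp.count_toMultiset]

/-- If the relations between the `q y` include all binomial relations between the monomials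
`t y`, then all relations between the latter hold between the former. -/
theorem aeval_eq_zero_of_monomial {σ P Q K : Type*} [Field K] [CommRing Q] [Algebra K Q]
    {q : σ → Q} {t : σ → MvPolynomial P K} {good : σ → Prop} {e : σ → P →₀ ℕ}
    (hq : ∀ y, ¬ good y → q y = 0) (ht : ∀ y, ¬ good y → t y = 0)
    (he : ∀ y, good y → t y = monomial (e y) 1)
    (h : ∀ m m' : Multiset σ, (∀ y ∈ m, good y) → (∀ y ∈ m', good y) →
      (m.map e).sum = (m'.map e).sum → (m.map q).prod = (m'.map q).prod)
    {g : MvPolynomial σ K} (hg : aeval t g = 0) : aeval q g = 0 := by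
  classical
  -- An exponent is sent to the product of `q` over some good collection with this exponent; by `h`
  -- the choice does not matter. The value 0 serves exponents that do not occur. Thus `aeval q`
  -- factors linearly through `aeval t`.
  let c : (P →₀ ℕ) → Q := fun a =>
    if h : ∃ m : Multiset σ, (∀ y ∈ m, good y) ∧ (m.map e).sum = a then (h.choose.map q).prod else 0
  let ℓ : MvPolynomial P K →ₗ[K] Q := (basisMonomials P K).constr K c
  have hℓ : ∀ a, ℓ (monomial a 1) = c a := fun a => by
    have := (basisMonomials P K).constr_basis K c a
    rwa [coe_basisMonomials] at this
  have key : (aeval q).toLinearMap = ℓ ∘ₗ (aeval t).toLinearMap := by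
    refine (basisMonomials σ K).ext fun s => ?_
    rw [coe_basisMonomials, LinearMap.comp_apply, AlgHom.toLinearMap_apply,
      AlgHom.toLinearMap_apply, aeval_monomial_one, aeval_monomial_one]
    by_cases hs : ∀ y ∈ s.toMultiset, good y
    · have e₁ : (s.toMultiset.map t).prod = monomial (s.toMultiset.map e).sum 1 := by
        generalize s.toMultiset = m at hs
        induction m using Multiset.induction with
        | empty => simp
        | cons y m ih =>
          rw [Multiset.map_cons, Multiset.prod_cons, Multiset.map_cons, Multiset.sum_cons,
            ih fun c hc => hs c (Multiset.mem_cons_of_mem hc),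
            he y (hs y (Multiset.mem_cons_self _ _)),
            monomial_mul, one_mul]
      have hex : ∃ m : Multiset σ, (∀ y ∈ m, good y) ∧ (m.map e).sum = (s.toMultiset.map e).sum :=
        ⟨_, hs, rfl⟩
      rw [e₁, hℓ]
      change _ = dite _ _ _
      rw [dif_pos hex]
      exact h _ _ hs hex.choose_spec.1 hex.choose_spec.2.symm
    · push Not at hs
      obtain ⟨y, hy, hgood⟩ := hs
      rw [Multiset.prod_eq_zero (Multiset.mem_map.2 ⟨y, hy, hq y hgood⟩),
        Multiset.prod_eq_zero (Multiset.mem_map.2 ⟨y, hy, ht y hgood⟩), map_zero]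
  have := LinearMap.congr_fun key g
  rwa [LinearMap.comp_apply, AlgHom.toLinearMap_apply, AlgHom.toLinearMap_apply, hg,
    map_zero] at this

/-- Collections of observed variables with the same exponent have the same product modulo the
generators. -/
theorem IsPolytree.prod_varClass_eq [Fintype V] (hG : IsPolytree G) {O : Set V}
    {top : observedVars O → V} {m m' : Multiset (observedVars O)}
    (hm : ∀ x ∈ m, IsMeet G (sinks x.1) (top x)) (hm' : ∀ x ∈ m', IsMeet G (sinks x.1) (top x))
    (h : (m.map fun x => trekExponent G x.1 (top x)).sum =
      (m'.map fun x => trekExponent G x.1 (top x)).sum) :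
    (m.map (varClass G O)).prod = (m'.map (varClass G O)).prod := by
  have hmeet : ∀ m : Multiset (observedVars O), (∀ x ∈ m, IsMeet G (sinks x.1) (top x)) →
      ∀ p ∈ m.map fun x => (x.1, top x), IsMeet G (sinks p.1) p.2 := by
    intro m hm p hp
    obtain ⟨x, hx, rfl⟩ := Multiset.mem_map.1 hp
    exact hm x hx
  have htrek : ∀ m : Multiset (observedVars O), (∀ x ∈ m, IsMeet G (sinks x.1) (top x)) →
      ∀ t ∈ (m.map fun x => (x.1, top x)).map fun p => (p.2, sinks p.1),
        IsObservedTrek G O t := by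
    intro m hm t ht
    obtain ⟨p, hp, rfl⟩ := Multiset.mem_map.1 ht
    obtain ⟨x, hx, rfl⟩ := Multiset.mem_map.1 hp
    refine ⟨?_, mem_observedVars_iff.1 x.2, (hm x hx).branches hG⟩
    obtain ⟨x | x, -⟩ := x
    · exact Or.inl (card_sinks (Sum.inl x))
    · exact Or.inr (card_sinks (Sum.inr x))
  have hclass : ∀ m : Multiset (observedVars O), m.map (varClass G O) =
      ((m.map fun x => (x.1, top x)).map fun p => (p.2, sinks p.1)).map (trekClass G O) := by
    intro m
    rw [Multiset.map_map, Multiset.map_map]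
    exact Multiset.map_congr rfl fun x _ => (trekClass_sinks x _).symm
  rw [hclass, hclass]
  refine prod_eq_of_sameSteps hG (exchangeRelations_trekClass O) (htrek m hm) (htrek m' hm')
    (hG.sameSteps_of_exponents (hmeet m hm) (hmeet m' hm') ?_)
  rw [Multiset.map_map, Multiset.map_map]
  exact h

/-- The relations between the monomials of the parametrization hold for all `q` which satisfy the
binomial ones. -/
theorem IsPolytree.aeval_eq_zero_of_trekParam [Fintype V] (hG : IsPolytree G) {O : Set V}
    {Q : Type*} [CommRing Q] [Algebra ℂ Q] {q : observedVars O → Q}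
    (hq : ∀ x, (¬ ∃ v, IsMeet G (sinks x.1) v) → q x = 0)
    (h : ∀ (top : observedVars O → V) (m m' : Multiset (observedVars O)),
      (∀ x ∈ m, IsMeet G (sinks x.1) (top x)) → (∀ x ∈ m', IsMeet G (sinks x.1) (top x)) →
      (m.map fun x => trekExponent G x.1 (top x)).sum =
        (m'.map fun x => trekExponent G x.1 (top x)).sum → (m.map q).prod = (m'.map q).prod)
    {g : MvPolynomial (observedVars O) ℂ}
    (hg : aeval (fun x : observedVars O => trekParam G x.1) g = 0) : aeval q g = 0 := by
  have : Nonempty V := hG.2.1.nonempty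
  obtain ⟨top, htop⟩ : ∃ top : observedVars O → V, ∀ x : observedVars O,
      (∃ v, IsMeet G (sinks x.1) v) → IsMeet G (sinks x.1) (top x) :=
    ⟨fun x => Classical.epsilon (IsMeet G (sinks x.1)), fun x hx => Classical.epsilon_spec hx⟩
  refine aeval_eq_zero_of_monomial (good := fun x : observedVars O => ∃ v, IsMeet G (sinks x.1) v)
    (e := fun x => trekExponent G x.1 (top x)) hq
    (fun x hx => trekParam_eq_zero hx) (fun x hx => ?_) (fun m m' hm hm' hsum => ?_) hg
  · rw [hG.trekParam_of_isMeet (htop x hx), trekMonomial_eq (htop x hx).1]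
  · exact h top m m' (fun x hx => htop x (hm x hx)) (fun x hx => htop x (hm' x hx)) hsum

/-- The polynomials in the kernel of the monomial parametrization lie in the generated ideal. -/
theorem IsPolytree.mem_generatedIdeal [Fintype V] (hG : IsPolytree G) {O : Set V}
    {f : observedRing O} (hf : aeval (trekParam G) (f : MomentRing V) = 0) :
    f ∈ generatedIdeal G O := by
  obtain ⟨g, rfl⟩ := (supportedEquivMvPolynomial (observedVars O)).symm.surjective f
  -- Identifying the observed ring with a polynomial ring in the observed variables turns the
  -- parametrization and the quotient map into evaluations, at `trekParam` and at `varClass`.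
  have e₁ : ((aeval (trekParam G)).comp (observedRing O).val).comp
      (supportedEquivMvPolynomial (observedVars O)).symm.toAlgHom =
      aeval fun x : observedVars O => trekParam G x.1 := by
    ext1 x
    simp
  have e₂ : (Ideal.Quotient.mkₐ ℂ (generatedIdeal G O)).comp
      (supportedEquivMvPolynomial (observedVars O)).symm.toAlgHom = aeval (varClass G O) := by
    ext1 x
    rw [aeval_X]
    exact congrArg (Ideal.Quotient.mk (generatedIdeal G O))
      (Subtype.ext (supportedEquivMvPolynomial_symm_X _ x))
  have h := hG.aeval_eq_zero_of_trekParam (fun x hx => hG.varClass_eq_zero x hx)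
    (fun _ _ _ => hG.prod_varClass_eq) ((AlgHom.congr_fun e₁ g).symm.trans hf)
  rw [← e₂] at h
  exact Ideal.Quotient.eq_zero_iff_mem.1 h

end ThirdMoment

end

/-! ### Generators of the observed variable ideal -/

theorem mainTheorem6 {V : Type*} [Fintype V] [DecidableEq V] (G : Digraph V)
    (hG : ThirdMoment.IsPolytree G) (H O : Set V)
    (hHO : ThirdMoment.IsUpstreamPartition G H O) :
    ThirdMoment.observedIdeal G O =
      Ideal.span {f : ThirdMoment.observedRing O |
        (f : ThirdMoment.MomentRing V) ∈
          ThirdMoment.observedMinors G O ∪ ThirdMoment.observedLinear G O} := by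
  refine le_antisymm (fun f hf => ?_) ?_
  · exact hG.mem_generatedIdeal (hG.aeval_trekParam_eq_zero hf)
  · exact Ideal.span_le.2 fun f hf => hG.generators_subset_momentIdeal O hf
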